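/- Words are finite words over the alphabet $\{0,1\}$; $w[i]$ is the $i$-th letter of $w$ ($1\le i\le |w|$), $w[i..j]=w[i]\cdots w[j]$, and $\overline c$ is the letter other than $c$. A period of a word $u$ is an integer $p\ge 1$ with $u[i+p]=u[i]$ for $1\le i\le |u|-p$; the period of $u$ is its least period. A run of $w$ is an interval $[i..j]$, $1\le i<j\le |w|$, such that, with $p$ the least period of $w[i..j]$, we have $j-i+1\ge 2p$, and ($i=1$ or $w[i-1]\ne w[i-1+p]$), and ($j=|w|$ or $w[j+1]\neq w[j+1-p]$). Let $\rho(n)$ be the maximal number of runs in a binary word of length $n$. For a letter $c$ let $\prec_c$ be the lexicographic order with $c\prec_c\overline c$. A nonempty word $u$ is $\prec_c$-Lyndon if $u\ne yx$ and $u\prec_c yx$ for every factorization $u=xy$ with $x,y$ nonempty. For a position $1<i\le|w|$ put $c_w(i)=\overline{w[i-1]}$, and let $L_w(i)$ be the largest $j$ such that $w[i..j]$ is $\prec_{c_w(i)}$-Lyndon, $D_w(i)=L_w(i)-i+1$, $S_w(i)$ the least $j$ such that $D_w(i)$ is a period of $w[j..L_w(i)]$, $E_w(i)$ the largest $j$ such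 that $D_w(i)$ is a period of $w[i..j]$, and $R_w(i)=[S_w(i)..E_w(i)]$. For a run $r=[s..e]$ of $w$ define a position $C_w(r)$ as follows. If $e<|w|$, then $C_w(r)=\max\{i : R_w(i)=r\}$. If $e=|w|$, let $r_w(c)=\min\{i : R_w(i)=r \text{ and } w[i..L_w(i)] \text{ is } \prec_c\text{-Lyndon}\}$ for each letter $c$, let $f_w(r)$ be the letter with $r_w(f_w(r))\ge r_w(\overline{f_w(r)})$ (with $f_w(r)=0$ if the period of $w[s..e]$ is one), and let $C_w(r)=\max\{i : R_w(i)=r\text{ and } w[i..L_w(i)]\text{ is }\prec_{f_w(r)}\text{-Lyndon}\}$. A position $1<i\le |w|$ of $w$ is (a) charged if $i=C_w(r)$ for some run $r$ of $w$; (b) right open if $E_w(i)=|w|$ and one of the following holds: $R_w(i)$ is not a run; or $r=R_w(i)$ is a run and $w[i..L_w(i)]$ is not $\prec_{f_w(r)}$-Lyndon; or $i=S_w(i)$; (c) left open if $S_w(i)=1$ and $R_w(i)$ is not a run; (d) lost if it is neither charged, nor right open, nor left open. For a real number $d$ and a word $w$ with lost positions $p_1<p_2<\dots<p_k$, let $P_d(w)$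 mean that $p_j-1\ge jd$ for all $j=1,\dots,k$. Let $N_d\in\mathbb N\cup\{\infty\}$ be the maximal length of a word $w$ satisfying $P_d(w)$ ($N_d=\infty$ if these lengths are unbounded). **Theorem.** Let $d$ be a real number such that $N_d$ is finite. Then the limit $\lim_{n\to\infty}\rho(n)/n$ exists and $$\lim_{n\to\infty}\frac{\rho(n)}{n}<1-\frac1d .$$ -/

import Mathlib

namespace LostPositions

/-! Binary words are lists over `Bool`, with `false` and `true` for the letters `0` and `1`.
Positions of `w` are numbered `1, 2, ..., |w|`. -/

/-- The letter `w[i]` (meaningful for `1 ≤ i ≤ |w|`). -/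
def letter (w : List Bool) (i : ℕ) : Bool := w.getD (i - 1) false

/-- The factor `w[i..j] = w[i] w[i+1] ⋯ w[j]` (meaningful for `1 ≤ i ≤ j ≤ |w|`). -/
def factor (w : List Bool) (i j : ℕ) : List Bool := (w.drop (i - 1)).take (j + 1 - i)

/-- `p` is a (positive) period of the word `u`: `u[i+p] = u[i]` for `1 ≤ i ≤ |u| - p`. -/
def IsPeriod (u : List Bool) (p : ℕ) : Prop :=
  0 < p ∧ ∀ i, 1 ≤ i → i + p ≤ u.length → letter u (i + p) = letter u i

/-- The period of the word `u`, that is, its least period. -/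
noncomputable def leastPeriod (u : List Bool) : ℕ := sInf {p | IsPeriod u p}

/-- The interval `[i..j]`, encoded as the pair `(i, j)`, is a run of `w`. -/
def IsRun (w : List Bool) (r : ℕ × ℕ) : Prop :=
  1 ≤ r.1 ∧ r.1 < r.2 ∧ r.2 ≤ w.length ∧
  2 * leastPeriod (factor w r.1 r.2) ≤ r.2 - r.1 + 1 ∧
  (r.1 = 1 ∨
    letter w (r.1 - 1) ≠ letter w (r.1 - 1 + leastPeriod (factor w r.1 r.2))) ∧
  (r.2 = w.length ∨
    letter w (r.2 + 1) ≠ letter w (r.2 + 1 - leastPeriod (factor w r.1 r.2)))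

/-- The number of runs of `w`. -/
noncomputable def numRuns (w : List Bool) : ℕ := {r : ℕ × ℕ | IsRun w r}.ncard

/-- `ρ(n)`: the maximal number of runs in a binary word of length `n`. -/
noncomputable def rho (n : ℕ) : ℕ :=
  Finset.univ.sup fun v : Fin n → Bool => numRuns (List.ofFn v)

/-- The lexicographic order on words in which the letter `c` is smaller than the other letter. -/
def LexLT (c : Bool) (u v : List Bool) : Prop := List.Lex (fun a b => a = c ∧ b = !c) u v

/-- `u` is a Lyndon word with respect to the order `LexLT c`. -/
def IsLyndon (c : Bool) (u : List Bool) : Prop :=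
  u ≠ [] ∧ ∀ x y : List Bool, x ≠ [] → y ≠ [] → u = x ++ y → u ≠ y ++ x ∧ LexLT c u (y ++ x)

/-! Parameters of a position `1 < i ≤ |w|`. -/

/-- The letter distinct from `w[i-1]`; it determines the order associated with the position. -/
def orderAt (w : List Bool) (i : ℕ) : Bool := !(letter w (i - 1))

/-- The end of the longest Lyndon word starting at `i`, in the order associated with `i`. -/
noncomputable def lyndonEnd (w : List Bool) (i : ℕ) : ℕ :=
  sSup {j | i ≤ j ∧ j ≤ w.length ∧ IsLyndon (orderAt w i) (factor w i j)}

/-- The length of the longest Lyndon word starting at `i`. -/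
noncomputable def lyndonLength (w : List Bool) (i : ℕ) : ℕ := lyndonEnd w i - i + 1

/-- The Lyndon word `w[i..L_w(i)]` attached to the position `i`. -/
noncomputable def lyndonRoot (w : List Bool) (i : ℕ) : List Bool := factor w i (lyndonEnd w i)

/-- The start of the maximal extension of `[i..L_w(i)]` with period `D_w(i)`. -/
noncomputable def extStart (w : List Bool) (i : ℕ) : ℕ :=
  sInf {j | 1 ≤ j ∧ j ≤ lyndonEnd w i ∧ IsPeriod (factor w j (lyndonEnd w i)) (lyndonLength w i)}

/-- The end of the maximal extension of `[i..L_w(i)]` with period `D_w(i)`. -/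
noncomputable def extEnd (w : List Bool) (i : ℕ) : ℕ :=
  sSup {j | i ≤ j ∧ j ≤ w.length ∧ IsPeriod (factor w i j) (lyndonLength w i)}

/-- The interval `R_w(i)` assigned to the position `i`. -/
noncomputable def ext (w : List Bool) (i : ℕ) : ℕ × ℕ := (extStart w i, extEnd w i)

/-- The set of positions `i` with `R_w(i) = r`. -/
def preimage (w : List Bool) (r : ℕ × ℕ) : Set ℕ := {i | 1 < i ∧ i ≤ w.length ∧ ext w i = r}

/-- The set of positions `i` with `R_w(i) = r` whose Lyndon root is Lyndon for the order of `c`. -/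
def lyndonPreimage (w : List Bool) (r : ℕ × ℕ) (c : Bool) : Set ℕ :=
  {i | i ∈ preimage w r ∧ IsLyndon c (lyndonRoot w i)}

open Classical in
/-- The letter whose progression of Lyndon roots of `r` starts later (the letter `0` in the case of
a tie, which occurs only if the period of `r` is one). Used only for runs `r` that end at `|w|`. -/
noncomputable def lateLetter (w : List Bool) (r : ℕ × ℕ) : Bool :=
  if sInf (lyndonPreimage w r false) < sInf (lyndonPreimage w r true) then true else false

open Classical in
/-- The representative `C_w(r)` of the positions mapped to the run `r`. -/
noncomputable def representative (w : List Bool) (r : ℕ × ℕ) : ℕ :=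
  if r.2 < w.length then sSup (preimage w r)
  else sSup (lyndonPreimage w r (lateLetter w r))

/-- The position `i` is charged. -/
def Charged (w : List Bool) (i : ℕ) : Prop := ∃ r, IsRun w r ∧ i = representative w r

/-- The position `i` is right open. -/
def RightOpen (w : List Bool) (i : ℕ) : Prop :=
  extEnd w i = w.length ∧
    (¬ IsRun w (ext w i) ∨
      (IsRun w (ext w i) ∧ ¬ IsLyndon (lateLetter w (ext w i)) (lyndonRoot w i)) ∨
      i = extStart w i)

/-- The position `i` is left open. -/
def LeftOpen (w : List Bool) (i : ℕ) : Prop := extStart w i = 1 ∧ ¬ IsRun w (ext w i)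

/-- The position `i` of `w` is lost. -/
def Lost (w : List Bool) (i : ℕ) : Prop :=
  1 < i ∧ i ≤ w.length ∧ ¬ Charged w i ∧ ¬ RightOpen w i ∧ ¬ LeftOpen w i

open Classical in
/-- The finite set of all lost positions of `w`. -/
noncomputable def lostPositions (w : List Bool) : Finset ℕ :=
  (Finset.Icc 1 w.length).filter (Lost w)

/-- The predicate `P_d(w)`: if `p_1 < ⋯ < p_k` are all lost positions of `w`, then
`p_j - 1 ≥ j d` for all `j = 1, ..., k` (the index `j : Fin k` below is shifted by one). -/
def P (d : ℝ) (w : List Bool) : Prop :=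
  ∀ j : Fin (lostPositions w).card,
    ((lostPositions w).orderEmbOfFin rfl j : ℝ) - 1 ≥ ((j : ℕ) + 1 : ℝ) * d

/-- `N_d`: the maximal length of a word satisfying `P_d`, or `∞` if there is no maximum. -/
noncomputable def N (d : ℝ) : ℕ∞ := ⨆ (w : List Bool) (_ : P d w), (w.length : ℕ∞)

end LostPositions

/-!
Every run `r` of a word `w` is the interval `R_w(i)` of its representative `i = C_w(r)`. Indeed, if
`p` is the period of `r`, then `r` contains for each order a Lyndon word of length `p` that starts
after the first position of `r` (`exists_lyn`); if the period is broken after `r` by the least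
letter of the order, or if `r` ends at the end of `w`, then no longer Lyndon word starts there
(`not_lyn_of_perOn`). The order is the one associated with the position, because the letter before
the position is the last letter of the Lyndon word. So runs are counted by representatives, which
are not lost, and the number of runs of `w` is at most `|w|` minus the number of lost positions
(`numRuns_add_card_lostPositions_le`).

If `N_d` is finite, then every word of a certain length `B + 1` violates `P_d`: for some `m ≤ B`,
the number of its lost positions among `2, …, m + 1` exceeds `m / d`. A long word is cut into such
pieces. Their lost positions are to be compared with those of the long word
(`card_lostPositions_le`). A lost position of a factor `v` of `w` whose interval is not a run, or
ends before the end of `v`, remains lost in `w`. A lost position that belongs to a run ending at the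
end of `v` belongs to the late letter of that run. In `w` the order that matters may be the other
one; then the position is replaced by the preceding position of the run that belongs to the other
order, which exists because the other progression starts earlier. This replacement is injective
and decreases positions, so that the number of lost positions in a prefix of `v` is not greater than
the number of those in the corresponding part of `w`. Since only finitely many pairs of numbers
occur in the violations of `P_d`, there is a `δ > 1 / d` such that every word has at least
`δ (|w| - B')` lost positions for a constant `B'` (`exists_card_lostPositions_ge`). Hence
`ρ(n) ≤ (1 - δ) n + δ B'`.

The limit exists because `ρ` is almost superadditive: if `a < 2 ^ L`, then any two words of lengths
`a` and `b` can be joined by a separator of length `L` over which no run of the first word extends,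
since the continuation of such a run is determined by its period (`exists_separator`). With `L` of
order `√a`, this gives that `ρ(n) / n` converges to the supremum of `ρ(m) / (m + 2 ⌊√m⌋)`.
-/

namespace LostPositions

/-! ### Lyndon words and periods of factors of a sequence of letters -/

/-- The word `f i, f (i + 1), …, f (i + n - 1)` is a Lyndon word for the order with least letter
`c`, in the form used throughout: the word is nonempty, and each of its proper suffixes is
greater because of a mismatch inside that suffix. So the word is smaller than each of its
proper suffixes, and has no border. -/
def Lyn (c : Bool) (f : ℕ → Bool) (i n : ℕ) : Prop :=
  0 < n ∧ ∀ k, 0 < k → k < n → ∃ t, k + t < n ∧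
    (∀ t' < t, f (i + t') = f (i + k + t')) ∧ f (i + t) = c ∧ f (i + k + t) = !c

/-- `p` is a period of the word `f a, …, f b` (`p = 0` is not excluded). -/
def PerOn (f : ℕ → Bool) (p a b : ℕ) : Prop := ∀ k, a ≤ k → k + p ≤ b → f (k + p) = f k

lemma PerOn.mono {f : ℕ → Bool} {p a b a' b' : ℕ} (h : PerOn f p a b) (ha : a ≤ a')
    (hb : b' ≤ b) : PerOn f p a' b' :=
  fun k h1 h2 => h k (ha.trans h1) (h2.trans hb)

lemma PerOn.shift {f g : ℕ → Bool} {p a b d : ℕ} (h : PerOn f p a b)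
    (hfg : ∀ k, a ≤ k → k ≤ b → g (k + d) = f k) : PerOn g p (a + d) (b + d) := by
  intro k h1 h2
  obtain ⟨m, rfl⟩ : ∃ m, k = m + d := ⟨k - d, by omega⟩
  rw [show m + d + p = m + p + d by omega, hfg _ (by omega) (by omega),
    hfg _ (by omega) (by omega)]
  exact h m (by omega) (by omega)

lemma PerOn.shift_back {f g : ℕ → Bool} {p a b d : ℕ} (h : PerOn g p (a + d) (b + d))
    (hfg : ∀ k, a ≤ k → k ≤ b → g (k + d) = f k) : PerOn f p a b := by
  intro k h1 h2
  rw [← hfg _ (by omega) (by omega), ← hfg _ (by omega) (by omega)]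
  have := h (k + d) (by omega) (by omega)
  rwa [show k + d + p = k + p + d by omega] at this

lemma PerOn.eq_add_mul {f : ℕ → Bool} {p a b : ℕ} (h : PerOn f p a b) {k : ℕ} (hk : a ≤ k) (q : ℕ)
    (hq : k + p * q ≤ b) : f (k + p * q) = f k := by
  induction q with
  | zero => simp
  | succ q ih =>
    rw [Nat.mul_succ] at hq ⊢
    rw [← ih (by omega), ← h (k + p * q) (by omega) (by omega), Nat.add_assoc]

lemma Lyn.congr {c : Bool} {f g : ℕ → Bool} {i j n : ℕ} (h : Lyn c f i n)
    (hfg : ∀ t < n, f (i + t) = g (j + t)) : Lyn c g j n := by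
  refine ⟨h.1, fun k hk hkn => ?_⟩
  obtain ⟨t, h1, h2, h3, h4⟩ := h.2 k hk hkn
  refine ⟨t, h1, fun t' ht' => ?_, ?_, ?_⟩
  · rw [← hfg _ (by omega), Nat.add_assoc, ← hfg _ (by omega), h2 t' ht', Nat.add_assoc]
  · rw [← hfg _ (by omega), h3]
  · rw [Nat.add_assoc, ← hfg _ (by omega), ← h4, Nat.add_assoc]

lemma lyn_one (c : Bool) (f : ℕ → Bool) (i : ℕ) : Lyn c f i 1 :=
  ⟨one_pos, fun k h1 h2 => by omega⟩

lemma Lyn.not_perOn {c : Bool} {f : ℕ → Bool} {i n k : ℕ} (h : Lyn c f i n) (hk : 0 < k)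
    (hkn : k < n) : ¬ PerOn f k i (i + n - 1) := by
  intro hp
  obtain ⟨t, h1, -, h3, h4⟩ := h.2 k hk hkn
  have := hp (i + t) (by omega) (by omega)
  rw [show i + t + k = i + k + t by omega, h3, h4] at this
  simp at this

lemma Lyn.first {c : Bool} {f : ℕ → Bool} {i n : ℕ} (h : Lyn c f i n) (hn : 1 < n) : f i = c := by
  obtain ⟨t, h1, -, h3, h4⟩ := h.2 (n - 1) (by omega) (by omega)
  obtain rfl : t = 0 := by omega
  exact h3

lemma Lyn.last {c : Bool} {f : ℕ → Bool} {i n : ℕ} (h : Lyn c f i n) (hn : 1 < n) :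
    f (i + n - 1) = !c := by
  obtain ⟨t, h1, -, h3, h4⟩ := h.2 (n - 1) (by omega) (by omega)
  obtain rfl : t = 0 := by omega
  rw [← h4]; congr 1; omega

lemma Lyn.order_unique {c c' : Bool} {f : ℕ → Bool} {i n : ℕ} (h : Lyn c f i n)
    (h' : Lyn c' f i n) (hn : 1 < n) : c = c' := by rw [← h.first hn, ← h'.first hn]

/-- If a word of period `p` ends at the end of the whole word, or is followed by the least
letter that breaks the period, then no word longer than `p` that starts in it at distance at
least `p` from its end is Lyndon: its suffix after `p` letters is not greater. -/
lemma not_lyn_of_perOn {c : Bool} {f : ℕ → Bool} {i p e N n : ℕ} (hper : PerOn f p i e)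
    (hp : 0 < p) (he : i + p ≤ e + 1) (hend : e = N ∨ f (e + 1) = c ∧ f (e + 1) ≠ f (e + 1 - p))
    (hn : p < n) (hN : i + n ≤ N + 1) : ¬ Lyn c f i n := by
  intro h
  obtain ⟨t, h1, h2, h3, h4⟩ := h.2 p hp hn
  by_cases hte : i + p + t ≤ e
  · have := hper (i + t) (by omega) (by omega)
    rw [show i + t + p = i + p + t by omega, h3, h4] at this
    simp at this
  · obtain rfl | ⟨h5, h6⟩ := hend
    · omega
    rcases Nat.lt_or_ge (e + 1 - p - i) t with hlt | hge
    · apply h6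
      have := h2 _ hlt
      rw [show i + (e + 1 - p - i) = e + 1 - p by omega,
        show i + p + (e + 1 - p - i) = e + 1 by omega] at this
      exact this.symm
    · rw [show i + p + t = e + 1 by omega, h5] at h4
      simp at h4

/-- A periodic continuation of a Lyndon word becomes a Lyndon word if the period is broken by
the greater letter. -/
lemma Lyn.extend {c : Bool} {f : ℕ → Bool} {i p e : ℕ} (h : Lyn c f i p) (hper : PerOn f p i e)
    (he : i + p ≤ e + 1) (h1 : f (e + 1) = !c) (h2 : f (e + 1 - p) = c) :
    Lyn c f i (e + 2 - i) := by
  have hp := h.1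
  refine ⟨by omega, fun k => ?_⟩
  induction k using Nat.strong_induction_on with
  | _ k ih =>
    intro hk hkn
    rcases lt_trichotomy k p with hkp | rfl | hkp
    · obtain ⟨t, h3, h4⟩ := h.2 k hk hkp
      exact ⟨t, by omega, h4⟩
    · refine ⟨e + 1 - i - k, by omega, fun t' ht' => ?_, ?_, ?_⟩
      · rw [show i + k + t' = i + t' + k by omega]
        exact (hper _ (by omega) (by omega)).symm
      · rw [← h2]; congr 1; omega
      · rw [← h1]; congr 1; omega
    · obtain ⟨t, h3, h4, h5, h6⟩ := ih (k - p) (by omega) (by omega) (by omega)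
      have shift : ∀ t', i + k + t' ≤ e → f (i + k + t') = f (i + (k - p) + t') := by
        intro t' ht'
        rw [show i + k + t' = i + (k - p) + t' + p by omega]
        exact hper _ (by omega) (by omega)
      by_cases hte : i + k + t ≤ e
      · refine ⟨t, by omega, fun t' ht' => ?_, h5, ?_⟩
        · rw [shift _ (by omega), h4 t' ht']
        · rw [shift _ hte, h6]
      · refine ⟨e + 1 - i - k, by omega, fun t' ht' => ?_, ?_, ?_⟩
        · rw [shift _ (by omega), h4 t' (by omega)]
        · rcases Nat.lt_or_ge (e + 1 - i - k) t with hlt | hge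
          · rw [h4 _ hlt, ← h2]; congr 1; omega
          · rw [show e + 1 - i - k = t by omega, h5]
        · rw [← h1]; congr 1; omega

/-- If a cyclic word is strictly smaller than all its proper rotations, then it is smaller than
its proper suffixes, with a mismatch inside the suffix. Indeed, if the suffix after `k` letters
were a border, then comparing with the rotations by `k` and by `n - k` would yield
opposite inequalities. -/
lemma lyn_of_cyclic {c : Bool} {g : ℕ → Bool} {i n : ℕ} (hn : 0 < n) (hg : ∀ x, g (x + n) = g x)
    (h : ∀ k, 0 < k → k < n → ∃ t < n,
      (∀ t' < t, g (i + t') = g (i + k + t')) ∧ g (i + t) = c ∧ g (i + k + t) = !c) :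
    Lyn c g i n := by
  refine ⟨hn, fun k hk hkn => ?_⟩
  obtain ⟨t, ht, h1, h2, h3⟩ := h k hk hkn
  by_cases hkt : k + t < n
  · exact ⟨t, hkt, h1, h2, h3⟩
  exfalso
  obtain ⟨u, hu, h4, h5, h6⟩ := h (n - k) (by omega) (by omega)
  -- the rotation by `n - k` has its first mismatch at `s`, with the letters in the wrong order
  obtain ⟨s, rfl⟩ : ∃ s, t = n - k + s := ⟨t - (n - k), by omega⟩
  have h7 : g (i + s) = !c := by
    rw [← h3, ← hg]; congr 1; omega
  have h8 : g (i + (n - k) + s) = c := by rw [← h2]; congr 1; omega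
  have h9 : ∀ t' < s, g (i + t') = g (i + (n - k) + t') := by
    intro t' ht'
    have := h1 (n - k + t') (by omega)
    rw [show i + (n - k) + t' = i + (n - k + t') by omega, this, ← hg]
    congr 1; omega
  rcases lt_trichotomy s u with hlt | rfl | hlt
  · have := h4 s hlt
    rw [h7, h8] at this; simp at this
  · rw [h5] at h7; simp at h7
  · have := h9 u hlt
    rw [h5, h6] at this; simp at this

/-- A word with least period `p` that has length at least `2 * p` contains a Lyndon word of
length `p` (for either order) that starts within its first `p` positions after the initial one. -/
lemma exists_lyn {f : ℕ → Bool} {p s e : ℕ} (hp : 0 < p) (hper : PerOn f p s e)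
    (hle : s + 2 * p ≤ e + 1) (hleast : ∀ q, 0 < q → q < p → ¬ PerOn f q s e) (c : Bool) :
    ∃ i, s < i ∧ i ≤ s + p ∧ Lyn c f i p := by
  -- `g` is the periodic sequence that agrees with `f` on `[s..e]` up to the shift by `s`
  set g : ℕ → Bool := fun x => f (s + x % p) with hgdef
  have hg : ∀ x, g (x + p) = g x := fun x => by simp [g]
  have hgf : ∀ x, s + x ≤ e → g x = f (s + x) := by
    intro x hx
    have hm : s + x % p + p * (x / p) = s + x := by
      have := Nat.mod_add_div x p; omega
    have := hper.eq_add_mul (k := s + x % p) (by omega) (x / p) (by omega)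
    rw [hm] at this
    exact this.symm
  have hgm : ∀ x, g (x % p) = g x := fun x => by simp [g]
  have hxor : ∀ c x y : Bool, xor c x < xor c y → x = c ∧ y = !c := by decide
  let V : ℕ → Lex (Fin p → Bool) := fun i => toLex fun t => xor c (g (i + t))
  obtain ⟨i, hi⟩ : ∃ i, ∀ j, V i ≤ V j := by
    obtain ⟨m, ⟨i, rfl⟩, hm⟩ := (Set.toFinite (Set.range V)).exists_minimal (Set.range_nonempty V)
    exact ⟨i, fun j => by
      rcases le_total (V i) (V j) with h | h
      · exact h
      · exact hm ⟨j, rfl⟩ h⟩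
  have hlyn : Lyn c g i p := by
    refine lyn_of_cyclic hp hg fun k hk hkp => ?_
    rcases (hi (i + k)).lt_or_eq with hlt | heq
    · obtain ⟨t, h1, h2⟩ := hlt
      refine ⟨t, t.2, fun t' ht' => ?_, ?_⟩
      · have := h1 ⟨t', by omega⟩ ht'
        simpa [V] using this
      · have h2 : xor c (g (i + t)) < xor c (g (i + k + t)) := h2
        exact hxor _ _ _ h2
    · exfalso
      have h1 : ∀ x, g (x + k) = g x := by
        have h2 : ∀ t < p, g (i + t) = g (i + k + t) := by
          intro t ht
          have := congrFun (congrArg ofLex heq) ⟨t, ht⟩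
          simpa [V] using this
        have h3 : ∀ x, i ≤ x → g (x + k) = g x := by
          intro x hx
          obtain ⟨y, rfl⟩ := Nat.exists_eq_add_of_le hx
          induction y using Nat.strong_induction_on with
          | _ y ih =>
            rcases Nat.lt_or_ge y p with hy | hy
            · rw [h2 y hy]; congr 1; omega
            · have := ih (y - p) (by omega) (by omega)
              rw [← hg, ← hg (i + (y - p))] at this
              convert this using 2 <;> omega
        intro x
        have h4 : ∀ m y, g (y + p * m) = g y := by
          intro m
          induction m with
          | zero => simp
          | succ m ih => intro y; rw [Nat.mul_succ, ← Nat.add_assoc, hg, ih]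
        have := h3 (x + p * i) (by nlinarith)
        rwa [h4, Nat.add_right_comm, h4] at this
      refine hleast k hk hkp fun x hx hxe => ?_
      obtain ⟨y, rfl⟩ := Nat.exists_eq_add_of_le hx
      rw [← hgf y (by omega), Nat.add_assoc, ← hgf _ (by omega), h1]
  obtain ⟨j, hj0, hjp, hj⟩ : ∃ j, 0 < j ∧ j ≤ p ∧ j % p = i % p := by
    rcases Nat.eq_zero_or_pos (i % p) with h0 | h0
    · exact ⟨p, hp, le_rfl, by simp [h0]⟩
    · exact ⟨i % p, h0, (Nat.mod_lt _ hp).le, by simp⟩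
  refine ⟨s + j, by omega, by omega, hlyn.congr fun t ht => ?_⟩
  rw [Nat.add_assoc, ← hgf _ (by omega), ← hgm (i + t), ← hgm (j + t), Nat.add_mod i, Nat.add_mod j,
    hj]

/-! ### Letters, factors, and the combinatorial predicates on lists -/

lemma letter_eq (w : List Bool) (i : ℕ) : letter w (i + 1) = w.getD i false := by
  simp [letter]

lemma length_factor {w : List Bool} {i j : ℕ} (hi : 1 ≤ i) (hj : j ≤ w.length) :
    (factor w i j).length = j + 1 - i := by
  simp only [factor, List.length_take, List.length_drop]; omega

lemma getD_factor {w : List Bool} {i j t : ℕ} (hi : 1 ≤ i) (ht : i + t ≤ j) :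
    (factor w i j).getD t false = letter w (i + t) := by
  obtain ⟨i, rfl⟩ := Nat.exists_eq_add_of_le' hi
  rw [show i + 1 + t = i + t + 1 by omega, letter_eq]
  simp only [factor, List.getD_eq_getElem?_getD, List.getElem?_take, List.getElem?_drop]
  rw [if_pos (by omega)]; simp

lemma lex_of_mismatch {c : Bool} (t : ℕ) : ∀ {u v : List Bool}, t < u.length → t < v.length →
    (∀ t' < t, u.getD t' false = v.getD t' false) → u.getD t false = c → v.getD t false = (!c) →
    LexLT c u v := by
  induction t with
  | zero =>
    rintro (_ | ⟨a, u⟩) (_ | ⟨b, v⟩) h1 h2 h3 h4 h5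
    · simp at h1
    · simp at h1
    · simp at h2
    · exact List.Lex.rel ⟨by simpa using h4, by simpa using h5⟩
  | succ t ih =>
    rintro (_ | ⟨a, u⟩) (_ | ⟨b, v⟩) h1 h2 h3 h4 h5
    · simp at h1
    · simp at h1
    · simp at h2
    · have h6 := h3 0 (by omega)
      simp only [List.getD_cons_zero] at h6
      subst h6
      refine List.Lex.cons (ih (by simpa using h1) (by simpa using h2) (fun t' ht' => ?_) ?_ ?_)
      · simpa using h3 (t' + 1) (by omega)
      · simpa using h4
      · simpa using h5

lemma LexLT.exists_mismatch {c : Bool} {u v : List Bool} (h : LexLT c u v)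
    (hl : u.length = v.length) : ∃ t < u.length,
    (∀ t' < t, u.getD t' false = v.getD t' false) ∧ u.getD t false = c ∧
      v.getD t false = !c := by
  unfold LexLT at h
  induction h with
  | nil => simp at hl
  | rel h => exact ⟨0, by simp, by simp, by simpa using h.1, by simpa using h.2⟩
  | cons h ih =>
    obtain ⟨t, h1, h2, h3, h4⟩ := ih (by simpa using hl)
    refine ⟨t + 1, by simpa using h1, fun t' ht' => ?_, by simpa using h3, by simpa using h4⟩
    rcases t' with _ | t'
    · simp
    · simpa using h2 t' (by omega)

lemma isLyndon_iff_lyn {c : Bool} {u : List Bool} :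
    IsLyndon c u ↔ Lyn c (fun t => u.getD t false) 0 u.length := by
  constructor
  · rintro ⟨h0, h⟩
    have hn : 0 < u.length := List.length_pos_iff.2 h0
    have key : Lyn c (fun t => u.getD (t % u.length) false) 0 u.length := by
      refine lyn_of_cyclic hn (fun x => by simp) fun k hk hkn => ?_
      have h1 := (h (u.take k) (u.drop k) (by simpa using ⟨hk.ne', h0⟩) (by simpa using hkn)
        (by simp)).2
      have hrot : ∀ t < u.length, (u.drop k ++ u.take k).getD t false
          = u.getD ((k + t) % u.length) false := by
        intro t ht
        rcases Nat.lt_or_ge (k + t) u.length with h2 | h2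
        · rw [List.getD_append _ _ _ _ (by simp; omega), Nat.mod_eq_of_lt h2]
          simp [List.getD_eq_getElem?_getD]
        · rw [List.getD_append_right _ _ _ _ (by simp; omega), Nat.mod_eq_sub_mod h2,
            Nat.mod_eq_of_lt (by omega)]
          simp only [List.getD_eq_getElem?_getD, List.getElem?_take, List.length_drop]
          rw [if_pos (by omega)]
          congr 2; omega
      obtain ⟨t, h2, h3, h4, h5⟩ := h1.exists_mismatch (by simp; omega)
      refine ⟨t, h2, fun t' ht' => ?_, ?_, ?_⟩
      · simp only [Nat.zero_add]
        rw [← hrot _ (by omega), Nat.mod_eq_of_lt (by omega), h3 t' ht']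
      · simp only [Nat.zero_add]
        rw [Nat.mod_eq_of_lt (by omega), h4]
      · simp only [Nat.zero_add]
        rw [← hrot _ (by omega), h5]
    exact key.congr fun t ht => by simp [Nat.mod_eq_of_lt ht]
  · rintro ⟨h0, h⟩
    refine ⟨List.length_pos_iff.1 h0, fun x y hx hy hu => ?_⟩
    have hx' := List.length_pos_iff.2 hx
    have hy' := List.length_pos_iff.2 hy
    have hl : u.length = x.length + y.length := by simp [hu]
    obtain ⟨t, h1, h2, h3, h4⟩ := h x.length hx' (by omega)
    simp only [Nat.zero_add] at h1 h2 h3 h4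
    have hrot : ∀ t, x.length + t < u.length →
        (y ++ x).getD t false = u.getD (x.length + t) false := by
      intro t ht
      rw [List.getD_append _ _ _ _ (by omega), hu, List.getD_append_right _ _ _ _ (by omega)]
      simp
    rw [← hrot t h1] at h4
    refine ⟨fun h5 => ?_, lex_of_mismatch t (by omega) (by simp; omega) (fun t' ht' => ?_) h3 h4⟩
    · rw [← h5, h3] at h4; simp at h4
    · rw [h2 t' ht', hrot _ (by omega)]

lemma isLyndon_factor {c : Bool} {w : List Bool} {i j : ℕ} (hi : 1 ≤ i) (hj : j ≤ w.length) :
    IsLyndon c (factor w i j) ↔ Lyn c (letter w) i (j + 1 - i) := by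
  rw [isLyndon_iff_lyn, length_factor hi hj]
  constructor <;> intro h <;> refine h.congr fun t ht => ?_
  · simp only [Nat.zero_add]; exact getD_factor hi (by omega)
  · simp only [Nat.zero_add]; exact (getD_factor hi (by omega)).symm

lemma isPeriod_factor {p : ℕ} {w : List Bool} {i j : ℕ} (hi : 1 ≤ i) (hj : j ≤ w.length) :
    IsPeriod (factor w i j) p ↔ 0 < p ∧ PerOn (letter w) p i j := by
  have hl : ∀ k, 1 ≤ k → i + k ≤ j + 1 → letter (factor w i j) k = letter w (i + k - 1) := by
    intro k hk hkj
    obtain ⟨k, rfl⟩ := Nat.exists_eq_add_of_le' hk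
    rw [letter_eq, getD_factor hi (by omega)]; rfl
  rw [IsPeriod, length_factor hi hj]
  refine and_congr_right fun hp => ⟨fun h k h1 h2 => ?_, fun h k h1 h2 => ?_⟩
  · have := h (k + 1 - i) (by omega) (by omega)
    rw [hl _ (by omega) (by omega), hl _ (by omega) (by omega)] at this
    convert this using 2 <;> omega
  · rw [hl _ (by omega) (by omega), hl _ (by omega) (by omega)]
    have := h (i + k - 1) (by omega) (by omega)
    convert this using 2; omega

/-- `[s..e]` is a run of `w` with least period `p`. -/
structure RunAt (w : List Bool) (p s e : ℕ) : Prop where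
  one_le : 1 ≤ s
  le_length : e ≤ w.length
  pos : 0 < p
  two_mul : s + 2 * p ≤ e + 1
  per : PerOn (letter w) p s e
  least : ∀ q, 0 < q → q < p → ¬ PerOn (letter w) q s e
  left : s = 1 ∨ letter w (s - 1) ≠ letter w (s - 1 + p)
  right : e = w.length ∨ letter w (e + 1) ≠ letter w (e + 1 - p)

lemma leastPeriod_factor {w : List Bool} {p s e : ℕ} (hs : 1 ≤ s) (he : e ≤ w.length) (hp : 0 < p)
    (hper : PerOn (letter w) p s e) (hleast : ∀ q, 0 < q → q < p → ¬ PerOn (letter w) q s e) :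
    leastPeriod (factor w s e) = p := by
  have hmem : p ∈ {p | IsPeriod (factor w s e) p} := (isPeriod_factor hs he).2 ⟨hp, hper⟩
  refine le_antisymm (Nat.sInf_le hmem) ?_
  have := (isPeriod_factor hs he).1 (Nat.sInf_mem ⟨p, hmem⟩)
  by_contra hlt
  exact hleast _ this.1 (not_le.1 hlt) this.2

lemma RunAt.leastPeriod_eq {w : List Bool} {p s e : ℕ} (h : RunAt w p s e) :
    leastPeriod (factor w s e) = p :=
  leastPeriod_factor h.one_le h.le_length h.pos h.per h.least

lemma RunAt.isRun {w : List Bool} {p s e : ℕ} (h : RunAt w p s e) : IsRun w (s, e) := by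
  have h1 := h.two_mul
  have h2 := h.pos
  refine ⟨h.one_le, ?_, h.le_length, ?_, ?_, ?_⟩ <;> simp only [h.leastPeriod_eq]
  · omega
  · omega
  · exact h.left
  · exact h.right

lemma IsRun.runAt {w : List Bool} {s e : ℕ} (h : IsRun w (s, e)) :
    RunAt w (leastPeriod (factor w s e)) s e := by
  obtain ⟨h1, h2, h3, h4, h5, h6⟩ := h
  simp only at h1 h2 h3 h4 h5 h6
  have hmem : leastPeriod (factor w s e) ∈ {p | IsPeriod (factor w s e) p} := by
    refine Nat.sInf_mem ⟨e + 1, (isPeriod_factor h1 h3).2 ⟨by omega, fun k _ _ => by omega⟩⟩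
  have := (isPeriod_factor h1 h3).1 hmem
  refine ⟨h1, h3, this.1, by omega, this.2, fun q hq hqp hper => ?_, h5, h6⟩
  exact absurd (Nat.sInf_le ((isPeriod_factor h1 h3).2 ⟨hq, hper⟩)) (not_le.2 hqp)

/-! ### The parameters of a position -/

/-- The parameters of the position `i` of `w`: the longest Lyndon word that starts at `i` has
length `l`, and `[s..e]` is its maximal extension of period `l`. -/
structure Pos (w : List Bool) (i l s e : ℕ) : Prop where
  one_lt : 1 < i
  le_length : i ≤ w.length
  lyn : Lyn (orderAt w i) (letter w) i l
  longest : ∀ n, l < n → i + n ≤ w.length + 1 → ¬ Lyn (orderAt w i) (letter w) i n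
  one_le : 1 ≤ s
  start_le : s ≤ i
  le_end : i + l ≤ e + 1
  end_le : e ≤ w.length
  per : PerOn (letter w) l s e
  left : s = 1 ∨ letter w (s - 1) ≠ letter w (s - 1 + l)
  right : e = w.length ∨ letter w (e + 1) ≠ letter w (e + 1 - l)

lemma Pos.pos {w : List Bool} {i l s e : ℕ} (h : Pos w i l s e) : 0 < l := h.lyn.1

lemma Pos.unique {w : List Bool} {i l s e l' s' e' : ℕ} (h : Pos w i l s e)
    (h' : Pos w i l' s' e') : l = l' ∧ s = s' ∧ e = e' := by
  have hl : l = l' := by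
    have h1 := h.le_end; have h2 := h.end_le; have h3 := h'.le_end; have h4 := h'.end_le
    rcases lt_trichotomy l l' with hlt | heq | hlt
    · exact absurd h'.lyn (h.longest _ hlt (by omega))
    · exact heq
    · exact absurd h.lyn (h'.longest _ hlt (by omega))
  subst hl
  have key : ∀ {s e s' e'}, Pos w i l s e → Pos w i l s' e' → s' ≤ s ∧ e ≤ e' := by
    intro s e s' e' h h'
    have := h.start_le; have := h'.start_le; have := h.le_end; have := h'.le_end
    have := h.end_le; have := h.one_le; have := h'.one_le
    refine ⟨?_, ?_⟩
    · by_contra hlt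
      rcases h'.left with h1 | h1
      · omega
      · exact h1 (h.per (s' - 1) (by omega) (by omega)).symm
    · by_contra hlt
      rcases h'.right with h1 | h1
      · omega
      · apply h1
        have := h.per (e' + 1 - l) (by omega) (by omega)
        rwa [Nat.sub_add_cancel (by omega)] at this
  exact ⟨rfl, le_antisymm (key h' h).1 (key h h').1, le_antisymm (key h h').2 (key h' h).2⟩

lemma perOn_union {f : ℕ → Bool} {l s i e : ℕ} (h1 : PerOn f l s (i + l - 1))
    (h2 : PerOn f l i e) : PerOn f l s e := by
  intro k hk hke
  rcases Nat.lt_or_ge k i with h | h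
  · exact h1 k hk (by omega)
  · exact h2 k h hke

lemma pos_self {w : List Bool} {i : ℕ} (hi : 1 < i) (hiw : i ≤ w.length) :
    Pos w i (lyndonLength w i) (extStart w i) (extEnd w i) := by
  have hL : lyndonEnd w i ∈
      {j | i ≤ j ∧ j ≤ w.length ∧ IsLyndon (orderAt w i) (factor w i j)} := by
    refine Nat.sSup_mem ⟨i, le_rfl, hiw, ?_⟩ ⟨w.length, fun j hj => hj.2.1⟩
    rw [isLyndon_factor hi.le hiw, Nat.add_sub_cancel_left]
    exact lyn_one _ _ _
  obtain ⟨hL1, hL2, hL3⟩ := hL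
  rw [isLyndon_factor hi.le hL2] at hL3
  have hl : i + lyndonLength w i = lyndonEnd w i + 1 := by rw [lyndonLength]; omega
  have hl0 : 0 < lyndonLength w i := by rw [lyndonLength]; omega
  have hS : extStart w i ∈ {j | 1 ≤ j ∧ j ≤ lyndonEnd w i ∧
      IsPeriod (factor w j (lyndonEnd w i)) (lyndonLength w i)} :=
    Nat.sInf_mem ⟨i, hi.le, hL1, (isPeriod_factor hi.le hL2).2 ⟨hl0, fun k _ _ => by omega⟩⟩
  have hSi : extStart w i ≤ i :=
    Nat.sInf_le ⟨hi.le, hL1, (isPeriod_factor hi.le hL2).2 ⟨hl0, fun k _ _ => by omega⟩⟩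
  obtain ⟨hS1, hS2, hS3⟩ := hS
  rw [isPeriod_factor hS1 hL2] at hS3
  have hbdd : BddAbove {j | i ≤ j ∧ j ≤ w.length ∧ IsPeriod (factor w i j) (lyndonLength w i)} :=
    ⟨w.length, fun j hj => hj.2.1⟩
  have hLE : lyndonEnd w i ∈
      {j | i ≤ j ∧ j ≤ w.length ∧ IsPeriod (factor w i j) (lyndonLength w i)} :=
    ⟨hL1, hL2, (isPeriod_factor hi.le hL2).2 ⟨hl0, fun k _ _ => by omega⟩⟩
  have hE : extEnd w i ∈
      {j | i ≤ j ∧ j ≤ w.length ∧ IsPeriod (factor w i j) (lyndonLength w i)} :=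
    Nat.sSup_mem ⟨_, hLE⟩ hbdd
  have hEL : lyndonEnd w i ≤ extEnd w i := le_csSup hbdd hLE
  obtain ⟨hE1, hE2, hE3⟩ := hE
  rw [isPeriod_factor hi.le hE2] at hE3
  refine ⟨hi, hiw, ?_, fun n hn hnw hlyn => ?_, hS1, hSi, by omega, hE2, ?_, ?_, ?_⟩
  · rwa [show lyndonLength w i = lyndonEnd w i + 1 - i by omega]
  · have : i + n - 1 ≤ lyndonEnd w i := by
      refine le_csSup ⟨w.length, fun j hj => hj.2.1⟩ ⟨by omega, by omega, ?_⟩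
      rw [isLyndon_factor hi.le (by omega)]
      rwa [show i + n - 1 + 1 - i = n by omega]
    omega
  · refine perOn_union (i := i) ?_ hE3.2
    rw [show i + lyndonLength w i - 1 = lyndonEnd w i by omega]
    exact hS3.2
  · by_contra hcon
    rw [not_or, not_not] at hcon
    have : extStart w i ≤ extStart w i - 1 := by
      refine Nat.sInf_le ⟨by omega, by omega, (isPeriod_factor (by omega) hL2).2
        ⟨hl0, fun k hk hke => ?_⟩⟩
      rcases Nat.lt_or_ge k (extStart w i) with h | h
      · rw [show k = extStart w i - 1 by omega]; exact hcon.2.symm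
      · exact hS3.2 k h hke
    omega
  · by_contra hcon
    rw [not_or, not_not] at hcon
    have : extEnd w i + 1 ≤ extEnd w i := by
      refine le_csSup hbdd ⟨by omega, by omega, (isPeriod_factor (by omega) (by omega)).2
        ⟨hl0, fun k hk hke => ?_⟩⟩
      rcases Nat.lt_or_ge (k + lyndonLength w i) (extEnd w i + 1) with h | h
      · exact hE3.2 k hk (by omega)
      · rw [show k + lyndonLength w i = extEnd w i + 1 by omega, hcon.2]
        congr 1; omega
    omega

lemma Pos.lyndonLength_eq {w : List Bool} {i l s e : ℕ} (h : Pos w i l s e) :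
    lyndonLength w i = l := ((pos_self h.one_lt h.le_length).unique h).1

lemma Pos.ext_eq {w : List Bool} {i l s e : ℕ} (h : Pos w i l s e) : ext w i = (s, e) := by
  obtain ⟨-, h1, h2⟩ := (pos_self h.one_lt h.le_length).unique h
  rw [ext, h1, h2]

lemma Pos.isLyndon_iff {w : List Bool} {i l s e : ℕ} (h : Pos w i l s e) (c : Bool) :
    IsLyndon c (lyndonRoot w i) ↔ Lyn c (letter w) i l := by
  have h1 := h.pos
  have h2 := h.le_end
  have h3 := h.end_le
  have h4 : lyndonEnd w i = i + l - 1 := by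
    have h5 := h.lyndonLength_eq
    have h6 : i ≤ lyndonEnd w i := by
      refine le_csSup ⟨w.length, fun j hj => hj.2.1⟩ ⟨le_rfl, h.le_length, ?_⟩
      rw [isLyndon_factor h.one_lt.le h.le_length, Nat.add_sub_cancel_left]
      exact lyn_one _ _ _
    rw [lyndonLength] at h5; omega
  rw [lyndonRoot, h4, isLyndon_factor h.one_lt.le (by omega)]
  rw [show i + l - 1 + 1 - i = l by omega]

/-- Since Lyndon words have no border, the extension has least period `l`. -/
lemma Pos.least {w : List Bool} {i l s e : ℕ} (h : Pos w i l s e) :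
    ∀ q, 0 < q → q < l → ¬ PerOn (letter w) q s e := by
  intro q hq hql hper
  have := h.le_end
  exact h.lyn.not_perOn hq hql (hper.mono h.start_le (by omega))

lemma Pos.runAt {w : List Bool} {i l s e : ℕ} (h : Pos w i l s e) (hr : s + 2 * l ≤ e + 1) :
    RunAt w l s e :=
  ⟨h.one_le, h.end_le, h.pos, hr, h.per, h.least, h.left, h.right⟩

lemma Pos.isRun_iff {w : List Bool} {i l s e : ℕ} (h : Pos w i l s e) :
    IsRun w (s, e) ↔ s + 2 * l ≤ e + 1 := by
  refine ⟨fun hr => ?_, fun hr => (h.runAt hr).isRun⟩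
  have := leastPeriod_factor h.one_le h.end_le h.pos h.per h.least
  have h1 := hr.runAt
  rw [this] at h1
  exact h1.two_mul

/-- The period of the extension of a Lyndon root is broken by the least letter, since otherwise
there would be a longer Lyndon word. -/
lemma Pos.break_right {w : List Bool} {i l s e : ℕ} (h : Pos w i l s e) :
    e = w.length ∨ letter w (e + 1) = orderAt w i ∧ letter w (e + 1) ≠ letter w (e + 1 - l) := by
  rcases h.right with h1 | h1
  · exact Or.inl h1
  by_cases he : e = w.length
  · exact Or.inl he
  refine Or.inr ⟨?_, h1⟩
  by_contra h2
  have h3 := Bool.eq_not_of_ne h2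
  have h4 : letter w (e + 1 - l) = orderAt w i := by
    rw [h3] at h1
    have := Bool.eq_not_of_ne h1.symm
    simpa using this
  have h5 := h.end_le
  have h6 := h.le_end
  exact h.longest _ (by omega) (by omega)
    (h.lyn.extend (h.per.mono h.start_le le_rfl) h.le_end h3 h4)

lemma Pos.mk' {w : List Bool} {i l s e : ℕ} (h1 : 1 < i) (hs : 1 ≤ s) (hsi : s ≤ i)
    (hle : i + l ≤ e + 1) (he : e ≤ w.length) (hper : PerOn (letter w) l s e)
    (hlyn : Lyn (orderAt w i) (letter w) i l)
    (hleft : s = 1 ∨ letter w (s - 1) ≠ letter w (s - 1 + l))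
    (hright : e = w.length ∨
      letter w (e + 1) = orderAt w i ∧ letter w (e + 1) ≠ letter w (e + 1 - l)) :
    Pos w i l s e := by
  have := hlyn.1
  exact ⟨h1, by omega, hlyn, fun n hn hnw => not_lyn_of_perOn (hper.mono hsi le_rfl) hlyn.1 hle
    hright hn hnw, hs, hsi, hle, he, hper, hleft, hright.imp_right And.right⟩

/-- A Lyndon word of length `p` inside a maximal interval of period `p` is the Lyndon root of its
position, unless it starts at the first position of the interval or the period is broken by the
greater letter. -/
lemma RunAt.pos_of_lyn {w : List Bool} {p s e i : ℕ} {c : Bool} (h : RunAt w p s e) (hsi : s < i)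
    (hie : i + p ≤ e + 1) (hlyn : Lyn c (letter w) i p)
    (hc : e = w.length ∨ letter w (e + 1) = c) : Pos w i p s e := by
  have hs := h.one_le
  have hp := h.pos
  have hlast : letter w (i - 1) = letter w (i + p - 1) := by
    have := h.per (i - 1) (by omega) (by omega)
    rw [← this]; congr 1; omega
  have hright : ∀ o, (e = w.length ∨ letter w (e + 1) = o) → (e = w.length ∨
      letter w (e + 1) = o ∧ letter w (e + 1) ≠ letter w (e + 1 - p)) := by
    intro o ho
    rcases ho with h1 | h1
    · exact Or.inl h1
    · exact h.right.imp_right fun h2 => ⟨h1, h2⟩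
  rcases Nat.lt_or_ge 1 p with hp1 | hp1
  · have ho : orderAt w i = c := by rw [orderAt, hlast, hlyn.last hp1]; simp
    refine Pos.mk' (by omega) hs hsi.le hie h.le_length h.per (by rwa [ho]) h.left ?_
    rw [ho]; exact hright c hc
  · obtain rfl : p = 1 := by omega
    refine Pos.mk' (by omega) hs hsi.le hie h.le_length h.per (lyn_one _ _ _) h.left ?_
    refine h.right.imp_right fun h2 => ⟨?_, h2⟩
    -- all letters of a run of period one are equal, so its end gives the letter before `i`
    have h3 : letter w (e + 1 - 1) = letter w (i - 1) := by
      have := h.per.eq_add_mul (k := i - 1) (by omega) (e + 1 - i) (by omega)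
      rw [← this]; congr 1; omega
    rw [h3] at h2
    exact Bool.eq_not_of_ne h2

/-- Every run has, for an order that fits the letter after it, a position to which it belongs. -/
lemma RunAt.exists_pos {w : List Bool} {p s e : ℕ} {c : Bool} (h : RunAt w p s e)
    (hc : e = w.length ∨ letter w (e + 1) = c) :
    ∃ i, s < i ∧ i ≤ s + p ∧ Lyn c (letter w) i p ∧ Pos w i p s e := by
  obtain ⟨i, h1, h2, h3⟩ := exists_lyn h.pos h.per h.two_mul h.least c
  have := h.two_mul
  exact ⟨i, h1, h2, h3, h.pos_of_lyn h1 (by omega) h3 hc⟩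

lemma pos_of_mem_preimage {w : List Bool} {i s e : ℕ} (h : i ∈ preimage w (s, e)) :
    Pos w i (lyndonLength w i) s e := by
  obtain ⟨h1, h2, h3⟩ := h
  have := pos_self h1 h2
  rw [ext, Prod.mk.injEq] at h3
  rwa [h3.1, h3.2] at this

lemma RunAt.pos_of_mem_preimage {w : List Bool} {i p s e : ℕ} (hr : RunAt w p s e)
    (h : i ∈ preimage w (s, e)) : Pos w i p s e := by
  have h1 := LostPositions.pos_of_mem_preimage h
  have h2 := leastPeriod_factor h1.one_le h1.end_le h1.pos h1.per h1.least
  rw [hr.leastPeriod_eq] at h2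
  rwa [← h2] at h1

lemma Pos.mem_preimage {w : List Bool} {i l s e : ℕ} (h : Pos w i l s e) :
    i ∈ preimage w (s, e) := ⟨h.one_lt, h.le_length, h.ext_eq⟩

lemma Pos.mem_lyndonPreimage {w : List Bool} {i l s e : ℕ} {c : Bool} (h : Pos w i l s e)
    (hc : Lyn c (letter w) i l) : i ∈ lyndonPreimage w (s, e) c :=
  ⟨h.mem_preimage, (h.isLyndon_iff c).2 hc⟩

/-- The position `i` is eligible to represent the interval `r`: it is mapped to `r` and, if `r`
ends at the end of `w`, its Lyndon root is Lyndon for the late letter. -/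
def Candidate (w : List Bool) (r : ℕ × ℕ) (i : ℕ) : Prop :=
  i ∈ preimage w r ∧ (r.2 = w.length → IsLyndon (lateLetter w r) (lyndonRoot w i))

lemma representative_eq {w : List Bool} {r : ℕ × ℕ} (hr : r.2 ≤ w.length) :
    representative w r = sSup {i | Candidate w r i} := by
  unfold representative Candidate
  split_ifs with h
  · congr 1; ext i
    simp only [Set.mem_ofPred_eq, iff_self_and]
    intro _ h2; omega
  · have : r.2 = w.length := by omega
    congr 1; ext i; simp [lyndonPreimage, this]

lemma bddAbove_candidate (w : List Bool) (r : ℕ × ℕ) : BddAbove {i | Candidate w r i} :=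
  ⟨w.length, fun _ hi => hi.1.2.1⟩

lemma candidate_representative {w : List Bool} {r : ℕ × ℕ} (hr : IsRun w r) :
    Candidate w r (representative w r) := by
  obtain ⟨s, e⟩ := r
  have hrun := hr.runAt
  rw [representative_eq hr.2.2.1]
  refine Nat.sSup_mem ?_ (bddAbove_candidate w _)
  by_cases he : e = w.length
  · obtain ⟨i, -, -, h1, h2⟩ := hrun.exists_pos (c := lateLetter w (s, e)) (Or.inl he)
    exact ⟨i, h2.mem_preimage, fun _ => (h2.isLyndon_iff _).2 h1⟩
  · obtain ⟨i, -, -, h1, h2⟩ := hrun.exists_pos (Or.inr rfl)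
    exact ⟨i, h2.mem_preimage, fun h => absurd h he⟩

lemma mem_lostPositions {w : List Bool} {i : ℕ} : i ∈ lostPositions w ↔ Lost w i := by
  simp only [lostPositions, Finset.mem_filter, Finset.mem_Icc, and_iff_right_iff_imp]
  exact fun h => ⟨h.1.le, h.2.1⟩

/-- Distinct runs have distinct representatives, and representatives are not lost. -/
lemma numRuns_add_card_lostPositions_le (w : List Bool) :
    numRuns w + (lostPositions w).card ≤ w.length := by
  have h1 : numRuns w ≤ ((Finset.Icc 1 w.length \ lostPositions w : Finset ℕ) : Set ℕ).ncard := by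
    refine Set.ncard_le_ncard_of_injOn (representative w) (fun r hr => ?_) (fun r hr r' hr' h => ?_)
      (Finset.finite_toSet _)
    · have hr : IsRun w r := hr
      have hc := (candidate_representative hr).1
      have h2 := hc.1
      have h3 := hc.2.1
      have hch : Charged w (representative w r) := ⟨r, hr, rfl⟩
      simp only [Finset.coe_sdiff, Set.mem_sdiff, Finset.mem_coe, Finset.mem_Icc, mem_lostPositions]
      exact ⟨⟨by omega, h3⟩, fun h4 => h4.2.2.1 hch⟩
    · have h2 := (candidate_representative hr).1.2.2
      have h3 := (candidate_representative hr').1.2.2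
      rw [← h2, h, h3]
  rw [Set.ncard_coe_finset] at h1
  have h2 : lostPositions w ⊆ Finset.Icc 1 w.length := fun i hi => by
    have h3 := (mem_lostPositions.1 hi).1
    exact Finset.mem_Icc.2 ⟨h3.le, (mem_lostPositions.1 hi).2.1⟩
  have h3 := Finset.card_sdiff_add_card_eq_card h2
  simp only [Nat.card_Icc, Nat.add_sub_cancel] at h3
  omega

/-! ### Lost positions of a factor -/

lemma lost_of_not_isRun {w : List Bool} {i l s e : ℕ} (h : Pos w i l s e)
    (hr : e + 1 < s + 2 * l) (hs : 1 < s) (he : e < w.length) : Lost w i := by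
  have hE := h.ext_eq
  have hnr : ¬ IsRun w (s, e) := fun hr' => by have := h.isRun_iff.1 hr'; omega
  rw [ext, Prod.mk.injEq] at hE
  refine ⟨h.one_lt, h.le_length, ?_, ?_, ?_⟩
  · rintro ⟨r, hr, rfl⟩
    have := (candidate_representative hr).1.2.2
    rw [h.ext_eq] at this
    exact hnr (this ▸ hr)
  · rintro ⟨h1, -⟩; omega
  · rintro ⟨h1, -⟩; omega

lemma lost_of_candidate {w : List Bool} {i j s e : ℕ} (hr : IsRun w (s, e))
    (hi : Candidate w (s, e) i) (hj : Candidate w (s, e) j) (hij : i < j)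
    (hs : e = w.length → s < i) : Lost w i := by
  have hE := hi.1.2.2
  refine ⟨hi.1.1, hi.1.2.1, ?_, ?_, ?_⟩
  · rintro ⟨r, hr', hir⟩
    have := (candidate_representative hr').1.2.2
    rw [← hir, hE] at this
    rw [← this, representative_eq hr.2.2.1] at hir
    have := le_csSup (bddAbove_candidate w (s, e)) hj
    omega
  · rintro ⟨h1, h2 | h2 | h2⟩
    · exact h2 (hE ▸ hr)
    · rw [hE] at h2
      rw [ext, Prod.mk.injEq] at hE
      exact h2.2 (hi.2 (by simp only; omega))
    · rw [ext, Prod.mk.injEq] at hE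
      have := hs (by omega)
      omega
  · rintro ⟨-, h2⟩
    exact h2 (hE ▸ hr)

lemma Lost.cases {w : List Bool} {i l s e : ℕ} (hi : Lost w i) (h : Pos w i l s e) :
    (e + 1 < s + 2 * l ∧ 1 < s ∧ e < w.length) ∨
    (RunAt w l s e ∧ Candidate w (s, e) i ∧ (e = w.length → s < i) ∧
      ∃ j, i < j ∧ Candidate w (s, e) j) := by
  obtain ⟨-, -, hc, hro, hlo⟩ := hi
  have hE := h.ext_eq
  have hE' := hE
  rw [ext, Prod.mk.injEq] at hE
  rw [RightOpen, hE', hE.1, hE.2] at hro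
  rw [LeftOpen, hE', hE.1] at hlo
  have := h.end_le
  have h1 := h.one_le
  have h2 := h.start_le
  by_cases hr : s + 2 * l ≤ e + 1
  · have hrun := (h.runAt hr).isRun
    have hcand : Candidate w (s, e) i := by
      refine ⟨h.mem_preimage, fun he => ?_⟩
      by_contra hl
      exact hro ⟨he, Or.inr (Or.inl ⟨hrun, hl⟩)⟩
    refine Or.inr ⟨h.runAt hr, hcand, fun he => ?_, representative w (s, e), ?_,
      candidate_representative hrun⟩
    · rcases h2.lt_or_eq with h3 | h3
      · exact h3
      · exact absurd ⟨he, Or.inr (Or.inr h3.symm)⟩ hro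
    · have hle : i ≤ representative w (s, e) := by
        rw [representative_eq h.end_le]
        exact le_csSup (bddAbove_candidate w _) hcand
      exact lt_of_le_of_ne hle fun heq => hc ⟨_, hrun, heq⟩
  · have hnr : ¬ IsRun w (s, e) := fun h => hr (Pos.isRun_iff (by assumption) |>.1 h)
    refine Or.inl ⟨by omega, ?_, ?_⟩
    · by_contra h3
      exact hlo ⟨by omega, hnr⟩
    · by_contra h3
      exact hro ⟨by omega, Or.inl hnr⟩

/-- The word `v` occurs in `w` after the first `d` letters. -/
structure OccursAt (v w : List Bool) (d : ℕ) : Prop where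
  le_length : d + v.length ≤ w.length
  letter_eq : ∀ k, 1 ≤ k → k ≤ v.length → letter w (k + d) = letter v k

/-- `[s..e]` is the maximal interval of `w` that contains `[a..b]` and has the period `p`. -/
structure MaxExt (w : List Bool) (p a b s e : ℕ) : Prop where
  one_le : 1 ≤ s
  start_le : s ≤ a
  le_end : b ≤ e
  le_length : e ≤ w.length
  per : PerOn (letter w) p s e
  left : s = 1 ∨ letter w (s - 1) ≠ letter w (s - 1 + p)
  right : e = w.length ∨ letter w (e + 1) ≠ letter w (e + 1 - p)

lemma exists_maxExt {w : List Bool} {p a b : ℕ} (hper : PerOn (letter w) p a b)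
    (ha : 1 ≤ a) (hb : b ≤ w.length) (hab : a + p ≤ b + 1) : ∃ s e, MaxExt w p a b s e := by
  have hR : ∀ n b, n = w.length - b → b ≤ w.length → a + p ≤ b + 1 → PerOn (letter w) p a b →
      ∃ e, b ≤ e ∧ e ≤ w.length ∧ PerOn (letter w) p a e ∧
        (e = w.length ∨ letter w (e + 1) ≠ letter w (e + 1 - p)) := by
    intro n
    induction n with
    | zero => intro b hn hb _ hper; exact ⟨b, le_rfl, hb, hper, Or.inl (by omega)⟩
    | succ n ih =>
      intro b hn hb hab hper
      by_cases h : letter w (b + 1) = letter w (b + 1 - p)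
      · obtain ⟨e, h1, h2⟩ := ih (b + 1) (by omega) (by omega) (by omega) (fun k hk hkb => by
          rcases Nat.lt_or_ge (k + p) (b + 1) with h3 | h3
          · exact hper k hk (by omega)
          · rw [show k + p = b + 1 by omega, h]; congr 1; omega)
        exact ⟨e, by omega, h2⟩
      · exact ⟨b, le_rfl, hb, hper, Or.inr h⟩
  obtain ⟨e, h1, h2, h3, h4⟩ := hR _ b rfl hb hab hper
  have hL : ∀ a, 1 ≤ a → PerOn (letter w) p a e → ∃ s, 1 ≤ s ∧ s ≤ a ∧ PerOn (letter w) p s e ∧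
      (s = 1 ∨ letter w (s - 1) ≠ letter w (s - 1 + p)) := by
    intro a ha
    induction a, ha using Nat.le_induction with
    | base => intro hper; exact ⟨1, le_rfl, le_rfl, hper, Or.inl rfl⟩
    | succ a ha ih =>
      intro hper
      by_cases h : letter w a = letter w (a + p)
      · obtain ⟨s, h1, h2, h3⟩ := ih fun k hk hke => by
          rcases Nat.lt_or_ge a k with h3 | h3
          · exact hper k h3 hke
          · rw [show k = a by omega, h]
        exact ⟨s, h1, by omega, h3⟩
      · exact ⟨a + 1, by omega, le_rfl, hper, Or.inr h⟩
  obtain ⟨s, h5, h6, h7, h8⟩ := hL a ha h3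
  exact ⟨s, e, h5, h6, h1, h2, h7, h8, h4⟩

lemma MaxExt.start_eq {v w : List Bool} {d p s e s' e' : ℕ} (hvw : OccursAt v w d)
    (h : MaxExt w p (s + d) (e + d) s' e') (he : e ≤ v.length) (hse : s + p ≤ e + 1) (hs : 1 < s)
    (hleft : s = 1 ∨ letter v (s - 1) ≠ letter v (s - 1 + p)) : s' = s + d := by
  have h1 := h.start_le
  have h2 := h.le_end
  by_contra hne
  have h3 := h.per (s - 1 + d) (by omega) (by omega)
  rw [Nat.add_right_comm, hvw.letter_eq _ (by omega) (by omega),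
    hvw.letter_eq _ (by omega) (by omega)] at h3
  rcases hleft with h4 | h4
  · omega
  · exact h4 h3.symm

lemma MaxExt.end_eq {v w : List Bool} {d p s e s' e' : ℕ} (hvw : OccursAt v w d)
    (h : MaxExt w p (s + d) (e + d) s' e') (he : e < v.length) (hse : s + p ≤ e + 1) (hs : 1 ≤ s)
    (hright : e = v.length ∨ letter v (e + 1) ≠ letter v (e + 1 - p)) : e' = e + d := by
  have h1 := h.start_le
  have h2 := h.le_end
  by_contra hne
  have h3 := h.per (e + 1 - p + d) (by omega) (by omega)
  rw [show e + 1 - p + d + p = e + 1 + d by omega, hvw.letter_eq _ (by omega) (by omega),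
    hvw.letter_eq _ (by omega) (by omega)] at h3
  rcases hright with h4 | h4
  · omega
  · exact h4 h3

/-- The maximal extension in `w` of a run of a factor `v` is a run of the same period. -/
lemma RunAt.maxExt {v w : List Bool} {d p s e s' e' : ℕ} (hvw : OccursAt v w d)
    (h : RunAt v p s e) (hm : MaxExt w p (s + d) (e + d) s' e') : RunAt w p s' e' := by
  have h1 := h.two_mul
  have h2 := hm.start_le
  have h3 := hm.le_end
  have h4 := h.one_le
  have h5 := h.le_length
  refine ⟨hm.one_le, hm.le_length, h.pos, by omega, hm.per, fun q hq hqp hper => ?_, hm.left,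
    hm.right⟩
  refine h.least q hq hqp ?_
  refine PerOn.shift_back (d := d) (g := letter w) (hper.mono h2 h3) fun k hk hke => ?_
  exact hvw.letter_eq _ (by omega) (by omega)

lemma RunAt.exists_maxExt {v w : List Bool} {d p s e : ℕ} (hvw : OccursAt v w d)
    (h : RunAt v p s e) : ∃ s' e', MaxExt w p (s + d) (e + d) s' e' := by
  have h1 := h.two_mul
  have h2 := h.one_le
  have h3 := h.le_length
  have h4 := hvw.le_length
  exact LostPositions.exists_maxExt
    (h.per.shift fun k hk hke => hvw.letter_eq _ (by omega) (by omega))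
    (by omega) (by omega) (by omega)

lemma Pos.exists_maxExt {v w : List Bool} {d i l s e : ℕ} (hvw : OccursAt v w d)
    (h : Pos v i l s e) : ∃ s' e', MaxExt w l (s + d) (e + d) s' e' := by
  have h1 := h.start_le
  have h2 := h.one_le
  have h3 := h.end_le
  have h4 := hvw.le_length
  have h5 := h.le_end
  exact LostPositions.exists_maxExt
    (h.per.shift fun k hk hke => hvw.letter_eq _ (by omega) (by omega))
    (by omega) (by omega) (by omega)

lemma Lyn.occursAt {v w : List Bool} {d : ℕ} (hvw : OccursAt v w d) {c : Bool} {i n : ℕ}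
    (hi : 1 ≤ i) (hn : i + n ≤ v.length + 1) :
    Lyn c (letter w) (i + d) n ↔ Lyn c (letter v) i n := by
  have h : ∀ t < n, letter w (i + d + t) = letter v (i + t) := by
    intro t ht
    rw [Nat.add_right_comm, hvw.letter_eq _ (by omega) (by omega)]
  exact ⟨fun h' => h'.congr h, fun h' => h'.congr fun t ht => (h t ht).symm⟩

lemma Pos.orderAt_add {v w : List Bool} {d i l s e : ℕ} (hvw : OccursAt v w d)
    (h : Pos v i l s e) : orderAt w (i + d) = orderAt v i := by
  have h1 := h.one_lt
  have h2 := h.le_length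
  rw [orderAt, orderAt, show i + d - 1 = i - 1 + d by omega,
    hvw.letter_eq _ (by omega) (by omega)]

/-- The Lyndon root of a position persists in a longer word, unless the period of its extension is
broken there by the greater letter. -/
lemma Pos.occursAt {v w : List Bool} {d i l s e s' e' : ℕ} (hvw : OccursAt v w d)
    (h : Pos v i l s e) (hm : MaxExt w l (s + d) (e + d) s' e')
    (hc : e' = w.length ∨ letter w (e' + 1) = orderAt v i) : Pos w (i + d) l s' e' := by
  have h1 := h.one_lt
  have h2 := h.le_end
  have h3 := h.end_le
  have h4 := hm.start_le
  have h5 := hm.le_end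
  have h6 := h.start_le
  refine Pos.mk' (by omega) hm.one_le (by omega) (by omega) hm.le_length hm.per ?_ hm.left ?_
  · rw [h.orderAt_add hvw, Lyn.occursAt hvw (by omega) (by omega)]
    exact h.lyn
  · rw [h.orderAt_add hvw]
    rcases hc with hc | hc
    · exact Or.inl hc
    · exact hm.right.imp_right fun h7 => ⟨hc, h7⟩

lemma Pos.occursAt_of_lt {v w : List Bool} {d i l s e s' e' : ℕ} (hvw : OccursAt v w d)
    (h : Pos v i l s e) (hm : MaxExt w l (s + d) (e + d) s' e') (he : e < v.length) :
    Pos w (i + d) l s' e' := by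
  have h1 := h.start_le
  have h2 := h.le_end
  have h3 := hm.end_eq hvw he (by omega) h.one_le h.right
  refine h.occursAt hvw hm (Or.inr ?_)
  rcases h.break_right with h4 | h4
  · omega
  · rw [h3, Nat.add_right_comm, hvw.letter_eq _ (by omega) (by omega), h4.1]

/-- Distinct conjugates of a word are not both Lyndon words for the same order. -/
lemma Lyn.add_le {c : Bool} {f : ℕ → Bool} {p i j s e : ℕ} (hi : Lyn c f i p) (hj : Lyn c f j p)
    (hper : PerOn f p s e) (hs : s ≤ i) (hij : i < j) (he : j + p ≤ e + 1) : i + p ≤ j := by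
  by_contra hlt
  obtain ⟨k, rfl⟩ := Nat.exists_eq_add_of_lt hij
  obtain ⟨t, h1, h2, h3, h4⟩ := hi.2 (k + 1) (by omega) (by omega)
  obtain ⟨u, h5, h6, h7, h8⟩ := hj.2 (p - (k + 1)) (by omega) (by omega)
  have hshift : ∀ x ≤ u, f (i + k + 1 + (p - (k + 1)) + x) = f (i + x) := by
    intro x hx
    rw [← hper (i + x) (by omega) (by omega)]
    congr 1; omega
  rw [hshift u le_rfl] at h8
  rcases lt_trichotomy t u with hlt | rfl | hlt
  · have := h6 t hlt
    rw [hshift t hlt.le, h3, ← Nat.add_assoc] at *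
    rw [h4] at this; simp at this
  · rw [h3] at h8; simp at h8
  · have := h2 u hlt
    rw [← Nat.add_assoc, h7, h8] at this; simp at this

lemma Pos.add {w : List Bool} {i l s e : ℕ} {c : Bool} (h : Pos w i l s e)
    (hc : Lyn c (letter w) i l) (hr : RunAt w l s e) (he : i + 2 * l ≤ e + 1) :
    Lyn c (letter w) (i + l) l ∧ (e = w.length → Pos w (i + l) l s e) := by
  have h1 := h.start_le
  have h2 : Lyn c (letter w) (i + l) l := by
    refine hc.congr fun t ht => ?_
    rw [← h.per (i + t) (by omega) (by omega)]
    congr 1; omega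
  have h3 := h.pos
  exact ⟨h2, fun hw => hr.pos_of_lyn (by omega) (by omega) h2 (Or.inl hw)⟩

lemma sInf_lateLetter (w : List Bool) (r : ℕ × ℕ) :
    sInf (lyndonPreimage w r (!lateLetter w r)) ≤ sInf (lyndonPreimage w r (lateLetter w r)) := by
  unfold lateLetter
  split_ifs with h
  · exact h.le
  · exact not_lt.1 h

/-- The positions `i` and `j` belong to the same interval, which ends at the end of `v`; the Lyndon
root of `i` belongs to the late letter and that of `j` to the other one, and `j` is the last such
position before `i`. The period is required to exceed one, so that only one of the two orders
fits each root. -/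
def Shifted (v : List Bool) (i j : ℕ) : Prop :=
  ∃ p s, Pos v i p s v.length ∧ Pos v j p s v.length ∧ 1 < p ∧
    Lyn (lateLetter v (s, v.length)) (letter v) i p ∧
    Lyn (!lateLetter v (s, v.length)) (letter v) j p ∧ j < i ∧ i ≤ j + p

lemma exists_shifted {v : List Bool} {i p s : ℕ} (hr : RunAt v p s v.length)
    (h : Pos v i p s v.length) (hp : 1 < p)
    (hi : Lyn (lateLetter v (s, v.length)) (letter v) i p) : ∃ j, Shifted v i j := by
  set f := lateLetter v (s, v.length) with hf
  obtain ⟨j, hjle, hj, hjl⟩ : ∃ j ≤ i, Pos v j p s v.length ∧ Lyn (!f) (letter v) j p := by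
    obtain ⟨k, -, -, h1, h2⟩ := hr.exists_pos (c := !f) (Or.inl rfl)
    have hmem := Nat.sInf_mem ⟨k, h2.mem_lyndonPreimage h1⟩
    refine ⟨_, (sInf_lateLetter v _).trans (Nat.sInf_le (h.mem_lyndonPreimage hi)), ?_⟩
    have h3 := hr.pos_of_mem_preimage hmem.1
    exact ⟨h3, (h3.isLyndon_iff _).1 hmem.2⟩
  have hne : ∀ j, Lyn (!f) (letter v) j p → j ≠ i := by
    rintro j hj rfl
    have := hi.order_unique hj hp
    simp at this
  have hh := h.le_end
  -- moving by one period as long as `i` is not reached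
  obtain ⟨n, hn⟩ : ∃ n, i - j = n := ⟨_, rfl⟩
  induction n using Nat.strong_induction_on generalizing j with
  | _ n ih =>
    have := hne j hjl
    rcases Nat.lt_or_ge (j + p) i with hlt | hge
    · obtain ⟨h1, h2⟩ := hj.add hjl hr (by omega)
      exact ih (i - (j + p)) (by omega) (j + p) hlt.le (h2 rfl) h1 rfl
    · exact ⟨j, p, s, h, hj, hp, hi, hjl, by omega, hge⟩

/-- A position that is lost in a factor `v` of `w` remains lost in `w`, unless it belongs to a run
that ends at the end of `v`, and the order relevant for that run is another one in `w`. In the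
latter case a position of `v` that belongs to the run, and to the other order, is lost in `w`; by
the choice of the late letter, this position can be chosen to precede the original one. -/
lemma Lost.occursAt {v w : List Bool} {d i : ℕ} (hvw : OccursAt v w d) (hi : Lost v i) :
    Lost w (i + d) ∨ ∃ j, Shifted v i j ∧ Lost w (j + d) := by
  obtain ⟨l, s, e, h⟩ : ∃ l s e, Pos v i l s e := ⟨_, _, _, pos_self hi.1 hi.2.1⟩
  have hle := h.le_end
  have hsi := h.start_le
  have hel := h.end_le
  have hvwl := hvw.le_length
  obtain ⟨s', e', hm⟩ := h.exists_maxExt hvw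
  have hms := hm.start_le
  have hme := hm.le_end
  rcases hi.cases h with ⟨h1, h2, h3⟩ | ⟨hrun, hci, hsi', k, hik, hck⟩
  · have hs' := hm.start_eq hvw hel (by omega) h2 h.left
    have he' := hm.end_eq hvw h3 (by omega) h.one_le h.right
    exact Or.inl (lost_of_not_isRun (h.occursAt_of_lt hvw hm h3) (by omega) (by omega) (by omega))
  have hrun' := hrun.maxExt hvw hm
  have hk := hrun.pos_of_mem_preimage hck.1
  have hkle := hk.le_end
  rcases hel.lt_or_eq with hlt | rfl
  · have he' := hm.end_eq hvw hlt (by omega) h.one_le h.right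
    refine Or.inl (lost_of_candidate hrun'.isRun (j := k + d)
      ⟨(h.occursAt_of_lt hvw hm hlt).mem_preimage, fun h1 => ?_⟩
      ⟨(hk.occursAt_of_lt hvw hm hlt).mem_preimage, fun h1 => ?_⟩ (by omega) (by omega)) <;>
    · simp only at h1; omega
  have hsi' := hsi' rfl
  set f := lateLetter v (s, v.length) with hf
  have hif : Lyn f (letter v) i l := (h.isLyndon_iff _).1 (hci.2 rfl)
  have hkf : Lyn f (letter v) k l := (hk.isLyndon_iff _).1 (hck.2 rfl)
  have hlen := h.one_lt
  -- `g` is the order relevant for the run in `w`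
  obtain ⟨g, hg1, hg2⟩ : ∃ g, (e' = w.length ∨ letter w (e' + 1) = g) ∧
      (e' = w.length → g = lateLetter w (s', e')) := by
    by_cases he : e' = w.length
    · exact ⟨_, Or.inl he, fun _ => rfl⟩
    · exact ⟨_, Or.inr rfl, fun h => absurd h he⟩
  have hcand : ∀ {x}, Pos w x l s' e' → Lyn g (letter w) x l → Candidate w (s', e') x :=
    fun hx hxl => ⟨hx.mem_preimage, fun h1 => (hx.isLyndon_iff _).2 (by rwa [← hg2 h1])⟩
  by_cases hcase : Lyn g (letter v) i l ∧ Lyn g (letter v) k l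
  · have h1 := (Lyn.occursAt hvw (by omega) (by omega)).2 hcase.1
    have h2 := (Lyn.occursAt hvw (by omega) (by omega)).2 hcase.2
    refine Or.inl (lost_of_candidate hrun'.isRun (j := k + d)
      (hcand (hrun'.pos_of_lyn (by omega) (by omega) h1 hg1) h1)
      (hcand (hrun'.pos_of_lyn (by omega) (by omega) h2 hg1) h2) (by omega) (by omega))
  have hl : 1 < l := by
    by_contra h1
    obtain rfl : l = 1 := by have := h.pos; omega
    exact hcase ⟨lyn_one _ _ _, lyn_one _ _ _⟩
  have hgf : g = !f := by
    refine Bool.eq_not_of_ne fun h1 => hcase ?_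
    rw [h1]; exact ⟨hif, hkf⟩
  obtain ⟨j, hj⟩ := exists_shifted hrun h hl hif
  refine Or.inr ⟨j, hj, ?_⟩
  obtain ⟨p, s₂, hp, hpj, -, -, hjl, hji, -⟩ := hj
  obtain ⟨rfl, rfl, -⟩ := h.unique hp
  rw [← hf, ← hgf] at hjl
  have hikl := hif.add_le hkf hrun.per hsi hik (by omega)
  obtain ⟨h1, h2⟩ := hpj.add hjl hrun (by omega)
  have horder : ∀ {x}, Pos v x l s v.length → Lyn g (letter v) x l → orderAt v x = g :=
    fun hx hxl => hx.lyn.order_unique hxl hl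
  have hjw := hpj.occursAt hvw hm (by rwa [horder hpj hjl])
  have hj2w := (h2 rfl).occursAt hvw hm (by rwa [horder (h2 rfl) h1])
  have hj1 := hpj.one_lt
  have hjlw := (Lyn.occursAt hvw hj1.le (by omega)).2 hjl
  have h1w := (Lyn.occursAt hvw (by omega) (by omega)).2 h1
  refine lost_of_candidate hrun'.isRun (hcand hjw hjlw) (hcand hj2w h1w) (by omega) fun he => ?_
  -- the first position of the run in `w` cannot start the progression of the late letter
  by_contra hcon
  have hg := hg2 he
  have hiw := (Lyn.occursAt hvw (by omega) (by omega)).2 hif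
  have hipos := hrun'.pos_of_lyn (i := i + d) (by omega) (by omega) hiw (Or.inl he)
  have hmem := Nat.sInf_mem ⟨_, hipos.mem_lyndonPreimage hiw⟩
  have hle := sInf_lateLetter w (s', e')
  rw [← hg, hgf, Bool.not_not] at hle
  have hle2 := Nat.sInf_le (hjw.mem_lyndonPreimage (hgf ▸ hjlw))
  have hs2 := (pos_of_mem_preimage hmem.1).start_le
  have heq : sInf (lyndonPreimage w (s', e') f) = j + d := by omega
  rw [heq] at hmem
  have := ((hjw.isLyndon_iff _).1 hmem.2).order_unique hjlw hl
  rw [hgf] at this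
  simp at this

/-- The number of lost positions in a prefix of a factor `v` of `w` does not exceed the number of
lost positions in the corresponding part of `w`. -/
lemma card_lostPositions_le {v w : List Bool} {d : ℕ} (hvw : OccursAt v w d) (m : ℕ) :
    ((lostPositions v).filter (· ≤ m)).card ≤
      ((lostPositions w).filter fun k => d + 1 < k ∧ k ≤ d + m).card := by
  classical
  have hex : ∀ i, ∃ j, Lost v i → Lost w (j + d) ∧ (j = i ∨ Shifted v i j) := by
    intro i
    by_cases hi : Lost v i
    · rcases hi.occursAt hvw with h | ⟨j, h1, h2⟩
      · exact ⟨i, fun _ => ⟨h, Or.inl rfl⟩⟩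
      · exact ⟨j, fun _ => ⟨h2, Or.inr h1⟩⟩
    · exact ⟨0, fun h => absurd h hi⟩
  choose φ hφ using hex
  refine Finset.card_le_card_of_injOn (fun i => φ i + d) ?_ ?_
  · intro i hi
    simp only [Finset.coe_filter, mem_lostPositions, Set.mem_ofPred_eq] at hi ⊢
    obtain ⟨h1, h2⟩ := hφ i hi.1
    rcases h2 with h2 | ⟨p, s, -, h3, -, -, -, h4, -⟩
    · exact ⟨h1, by have := hi.1.1; omega, by omega⟩
    · exact ⟨h1, by have := h3.one_lt; omega, by omega⟩
  -- a lost position is not the shift of another one, since it belongs to the late letter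
  have hne : ∀ {i j}, Lost v j → ¬ Shifted v i j := by
    rintro i j hj ⟨p, s, -, h2, h3, -, h5, -⟩
    rcases hj.cases h2 with h6 | ⟨-, h6, -⟩
    · omega
    · have := ((h2.isLyndon_iff _).1 (h6.2 rfl)).order_unique h5 h3
      simp at this
  have hinj : ∀ {i i' j}, Shifted v i j → Shifted v i' j → ¬ i < i' := by
    rintro i i' j ⟨p, s, h1, h2, -, h3, -, h4, h5⟩ ⟨p', s', h1', h2', -, h3', -, h4', h5'⟩ hlt
    obtain ⟨rfl, rfl, -⟩ := h2.unique h2'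
    have := h3.add_le h3' h1.per h1.start_le hlt h1'.le_end
    omega
  intro i hi i' hi' heq
  simp only [Finset.coe_filter, mem_lostPositions, Set.mem_ofPred_eq] at hi hi' heq
  obtain ⟨-, h2⟩ := hφ i hi.1
  obtain ⟨-, h2'⟩ := hφ i' hi'.1
  have heq : φ i = φ i' := by omega
  rcases h2 with h2 | h2 <;> rcases h2' with h2' | h2'
  · omega
  · rw [← heq, h2] at h2'
    exact absurd h2' (hne hi.1)
  · rw [heq, h2'] at h2
    exact absurd h2 (hne hi'.1)
  · rw [heq] at h2
    exact le_antisymm (not_lt.1 (hinj h2' h2)) (not_lt.1 (hinj h2 h2'))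

/-! ### Linear lower bound for the number of lost positions -/

lemma occursAt_drop_take {w : List Bool} {d n : ℕ} (h : d + n ≤ w.length) :
    OccursAt ((w.drop d).take n) w d := by
  have hl : ((w.drop d).take n).length = n := by simp; omega
  refine ⟨by omega, fun k hk hkn => ?_⟩
  obtain ⟨k, rfl⟩ := Nat.exists_eq_add_of_le' hk
  rw [show k + 1 + d = d + k + 1 by omega, letter_eq, letter_eq]
  simp only [List.getD_eq_getElem?_getD, List.getElem?_take, List.getElem?_drop]
  rw [if_pos (by omega)]

lemma exists_length_le {d : ℝ} (hd : N d ≠ ⊤) : ∃ B : ℕ, ∀ w, P d w → w.length ≤ B := by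
  obtain ⟨B, hB⟩ := WithTop.ne_top_iff_exists.1 hd
  refine ⟨B, fun w hw => ?_⟩
  have h : (w.length : ℕ∞) ≤ N d := le_iSup₂ (f := fun w (_ : P d w) => (w.length : ℕ∞)) w hw
  rw [← hB] at h
  exact Nat.cast_le.1 h

/-- A word that violates `P d` has a prefix with too many lost positions. -/
lemma exists_prefix_of_not_P {d : ℝ} {v : List Bool} (h : ¬ P d v) :
    ∃ m k : ℕ, 0 < m ∧ m < v.length ∧ k ≤ v.length ∧
      k ≤ ((lostPositions v).filter (· ≤ m + 1)).card ∧ (m : ℝ) < k * d := by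
  simp only [P, not_forall, not_le, ge_iff_le] at h
  obtain ⟨j, hj⟩ := h
  set p := (lostPositions v).orderEmbOfFin rfl j with hp
  have hlost : Lost v p := mem_lostPositions.1 (Finset.orderEmbOfFin_mem _ _ _)
  have h1 := hlost.1
  have h2 := hlost.2.1
  have hcard : (j : ℕ) + 1 ≤ ((lostPositions v).filter (· ≤ p)).card := by
    rw [← Fin.card_Iic j]
    refine Finset.card_le_card_of_injOn ((lostPositions v).orderEmbOfFin rfl) ?_
      (fun _ _ _ _ h => ((lostPositions v).orderEmbOfFin rfl).injective h)
    intro x hx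
    simp only [Finset.coe_filter, Set.mem_ofPred_eq, Finset.coe_Iic, Set.mem_Iic] at hx ⊢
    exact ⟨Finset.orderEmbOfFin_mem _ _ _, ((lostPositions v).orderEmbOfFin rfl).monotone hx⟩
  refine ⟨p - 1, j + 1, by omega, by omega, ?_, ?_, ?_⟩
  · have h3 : (lostPositions v).card ≤ v.length := by
      have := numRuns_add_card_lostPositions_le v
      omega
    omega
  · rwa [Nat.sub_add_cancel h1.le]
  · rw [Nat.cast_sub h1.le]
    push_cast
    exact hj

/-- The strict inequalities in the finitely many possible violations of `P d` hold uniformly. -/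
lemma exists_density {d : ℝ} (hd : 0 < d) (B : ℕ) : ∃ δ : ℝ, 1 / d < δ ∧
    ∀ m ≤ B, ∀ k ≤ B, (m : ℝ) < k * d → δ * m ≤ k := by
  have h : ∀ᶠ δ : ℝ in nhdsWithin (1 / d) (Set.Ioi (1 / d)), ∀ x ∈ Finset.range (B + 1) ×ˢ
      Finset.range (B + 1), ((x.1 : ℕ) : ℝ) < (x.2 : ℕ) * d → δ * (x.1 : ℕ) ≤ (x.2 : ℕ) := by
    rw [Filter.eventually_all_finset]
    rintro ⟨m, k⟩ -
    by_cases hmk : (m : ℝ) < k * d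
    · have hlt : 1 / d * m < k := by rw [one_div_mul_eq_div, div_lt_iff₀ hd]; exact hmk
      have hcont : Filter.Tendsto (fun δ : ℝ => δ * m) (nhds (1 / d)) (nhds (1 / d * m)) :=
        (continuous_mul_const (m : ℝ)).tendsto _
      filter_upwards [nhdsWithin_le_nhds (hcont.eventually (gt_mem_nhds hlt))] with δ hδ _
      exact hδ.le
    · exact Filter.Eventually.of_forall fun δ h => absurd h hmk
  obtain ⟨δ, h1, h2⟩ := (h.and self_mem_nhdsWithin).exists
  refine ⟨δ, h2, fun m hm k hk hmk => h1 (m, k) ?_ hmk⟩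
  simp only [Finset.mem_product, Finset.mem_range]
  omega

/-- A word is cut into blocks of bounded length such that each of them has many lost positions. -/
lemma exists_card_lostPositions_ge {d : ℝ} (hd : N d ≠ ⊤) : ∃ δ : ℝ, 1 / d < δ ∧ ∃ B : ℕ,
    ∀ w : List Bool, δ * ((w.length : ℝ) - B) ≤ (lostPositions w).card := by
  obtain ⟨B, hB⟩ := exists_length_le hd
  have hnot : ∀ v : List Bool, v.length = B + 1 → ¬ P d v := fun v hv hP => by
    have := hB v hP; omega
  have hd0 : 0 < d := by
    obtain ⟨m, k, h1, -, -, -, h2⟩ :=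
      exists_prefix_of_not_P (hnot (List.replicate (B + 1) true) (by simp))
    have h3 : (0 : ℝ) < m := by exact_mod_cast h1
    by_contra hd
    nlinarith [mul_nonneg (Nat.cast_nonneg (α := ℝ) k) (neg_nonneg.2 (not_lt.1 hd))]
  obtain ⟨δ, hδ, hδ'⟩ := exists_density hd0 (B + 1)
  have hδ0 : 0 < δ := lt_trans (by positivity) hδ
  refine ⟨δ, hδ, B + 1, fun w => ?_⟩
  have key : ∀ n a, n = w.length - a → 1 ≤ a →
      δ * ((w.length : ℝ) - a - B) ≤ ((lostPositions w).filter (a < ·)).card := by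
    intro n
    induction n using Nat.strong_induction_on with
    | _ n ih =>
      intro a hn ha
      rcases Nat.lt_or_ge (a + B) (w.length + 1) with hlt | hge
      · by_cases heq : a + B = w.length
        · rw [← heq]; push_cast; simp
        obtain ⟨a, rfl⟩ := Nat.exists_eq_add_of_le' ha
        have hocc : OccursAt ((w.drop a).take (B + 1)) w a := occursAt_drop_take (by omega)
        have hlen : ((w.drop a).take (B + 1)).length = B + 1 := by simp; omega
        obtain ⟨m, k, h1, h2, h3, h4, h5⟩ := exists_prefix_of_not_P (hnot _ hlen)
        have h6 := hδ' m (by omega) k (by omega) h5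
        have h7 := h4.trans (card_lostPositions_le hocc (m + 1))
        have h8 := ih (w.length - (a + 1 + m)) (by omega) (a + 1 + m) rfl (by omega)
        have h9 : ((lostPositions w).filter fun k => a + 1 < k ∧ k ≤ a + (m + 1)).card
            + ((lostPositions w).filter (a + 1 + m < ·)).card
            ≤ ((lostPositions w).filter (a + 1 < ·)).card := by
          rw [← Finset.card_union_of_disjoint]
          · refine Finset.card_le_card fun x hx => ?_
            simp only [Finset.mem_union, Finset.mem_filter] at hx ⊢
            rcases hx with hx | hx
            · exact ⟨hx.1, hx.2.1⟩
            · exact ⟨hx.1, by omega⟩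
          · rw [Finset.disjoint_left]
            intro x hx hx'
            simp only [Finset.mem_filter] at hx hx'
            omega
        have h10 : (k : ℝ) + ((lostPositions w).filter (a + 1 + m < ·)).card
            ≤ ((lostPositions w).filter (a + 1 < ·)).card := by exact_mod_cast by omega
        push_cast at h8 h10 ⊢
        linarith
      · have h1 : (w.length : ℝ) - a - B ≤ 0 := by
          have : (w.length : ℝ) ≤ a + B := by exact_mod_cast by omega
          linarith
        exact (mul_nonpos_of_nonneg_of_nonpos hδ0.le h1).trans (Nat.cast_nonneg _)
  have h1 := key _ 1 rfl le_rfl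
  have h2 : (((lostPositions w).filter (1 < ·)).card : ℝ) ≤ (lostPositions w).card := by
    exact_mod_cast Finset.card_filter_le _ _
  push_cast at h1 ⊢
  rw [sub_add_eq_sub_sub_swap]
  linarith

/-! ### Existence of the limit -/

lemma finite_isRun (w : List Bool) : {r | IsRun w r}.Finite := by
  refine (Set.finite_Icc ((0, 0) : ℕ × ℕ) (w.length, w.length)).subset fun r hr => ?_
  obtain ⟨h1, h2, h3, -⟩ := hr
  exact ⟨⟨Nat.zero_le _, Nat.zero_le _⟩, ⟨by simp only; omega, h3⟩⟩

/-- The maximal extensions in `w` of the runs of a factor `v` are distinct runs of `w`. -/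
lemma exists_extension_map {v w : List Bool} {d : ℕ} (hvw : OccursAt v w d) :
    ∃ Φ : ℕ × ℕ → ℕ × ℕ, Set.InjOn Φ {r | IsRun v r} ∧ ∀ s e, IsRun v (s, e) →
      IsRun w (Φ (s, e)) ∧ ∃ p, RunAt v p s e ∧
        MaxExt w p (s + d) (e + d) (Φ (s, e)).1 (Φ (s, e)).2 := by
  have hex : ∀ r : ℕ × ℕ, ∃ r' : ℕ × ℕ, IsRun v r → IsRun w r' ∧
      ∃ p, RunAt v p r.1 r.2 ∧ MaxExt w p (r.1 + d) (r.2 + d) r'.1 r'.2 := by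
    rintro ⟨s, e⟩
    by_cases hr : IsRun v (s, e)
    · obtain ⟨s', e', h⟩ := hr.runAt.exists_maxExt hvw
      exact ⟨(s', e'), fun _ => ⟨(hr.runAt.maxExt hvw h).isRun, _, hr.runAt, h⟩⟩
    · exact ⟨(0, 0), fun h => absurd h hr⟩
  choose Φ hΦ using hex
  refine ⟨Φ, ?_, fun s e hr => hΦ _ hr⟩
  rintro ⟨s, e⟩ hr ⟨s₂, e₂⟩ hr₂ heq
  obtain ⟨-, p, h1, h2⟩ := hΦ _ hr
  obtain ⟨-, p₂, h3, h4⟩ := hΦ _ hr₂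
  rw [← heq] at h4
  simp only at h1 h2 h3 h4
  have a1 := h1.two_mul
  have a2 := h3.two_mul
  have a3 := h1.one_le
  have a4 := h3.one_le
  have a5 := h1.le_length
  have a6 := h3.le_length
  have b1 := fun h => h2.start_eq hvw a5 (by omega) h h1.left
  have b2 := fun h => h4.start_eq hvw a6 (by omega) h h3.left
  have b3 := fun h => h2.end_eq hvw h (by omega) a3 h1.right
  have b4 := fun h => h4.end_eq hvw h (by omega) a4 h3.right
  have c1 := h2.start_le
  have c2 := h4.start_le
  have c3 := h2.le_end
  have c4 := h4.le_end
  have hs : s = s₂ := by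
    by_cases k1 : 1 < s <;> by_cases k2 : 1 < s₂ <;> simp only [k1, k2, true_implies] at b1 b2 <;>
      omega
  have he : e = e₂ := by
    by_cases k1 : e < v.length <;> by_cases k2 : e₂ < v.length <;>
      simp only [k1, k2, true_implies] at b3 b4 <;> omega
  rw [hs, he]

/-- Two words can be joined by a short separator such that no run of the first word extends over
the separator: a run that ends at the end of `u` is determined by its period, so there are at most
`u.length` separators to avoid. -/
lemma exists_separator (u v : List Bool) {L : ℕ} (hL : u.length < 2 ^ L) :
    ∃ x : List Bool, x.length = L ∧ numRuns u + numRuns v ≤ numRuns (u ++ x ++ v) := by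
  let g : ℕ → Fin L → Bool := fun p t => letter u (u.length - p + 1 + t % p)
  obtain ⟨x, -, hx⟩ : ∃ x ∈ (Finset.univ : Finset (Fin L → Bool)),
      x ∉ (Finset.Icc 1 u.length).image g := by
    refine Finset.exists_mem_notMem_of_card_lt_card (Finset.card_image_le.trans_lt ?_)
    simpa using hL
  set w := u ++ List.ofFn x ++ v with hw
  have hwl : w.length = u.length + L + v.length := by simp [hw, Nat.add_assoc]
  refine ⟨List.ofFn x, by simp, ?_⟩
  have hu : OccursAt u w 0 := by
    refine ⟨by omega, fun k hk hku => ?_⟩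
    obtain ⟨k, rfl⟩ := Nat.exists_eq_add_of_le' hk
    rw [Nat.add_zero, letter_eq, letter_eq, hw, List.append_assoc,
      List.getD_append _ _ _ _ (by omega)]
  have hv : OccursAt v w (u.length + L) := by
    refine ⟨by omega, fun k hk hkv => ?_⟩
    obtain ⟨k, rfl⟩ := Nat.exists_eq_add_of_le' hk
    rw [Nat.add_right_comm, letter_eq, letter_eq, hw,
      List.getD_append_right _ _ _ _ (by simp)]
    congr 1
    simp
  have hxw : ∀ t : Fin L, letter w (u.length + t + 1) = x t := by
    intro t
    rw [letter_eq, hw, List.getD_append _ _ _ _ (by simp),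
      List.getD_append_right _ _ _ _ (by omega)]
    simp [List.getD_eq_getElem?_getD]
  have hend : ∀ {p s e s' e'}, RunAt u p s e → MaxExt w p (s + 0) (e + 0) s' e' →
      e' < u.length + L := by
    intro p s e s' e' hr hm
    have h1 := hr.two_mul
    have h2 := hr.one_le
    have h3 := hr.pos
    have h4 := hm.start_le
    rcases hr.le_length.lt_or_eq with hlt | rfl
    · have := hm.end_eq hu hlt (by omega) h2 hr.right
      omega
    by_contra hge
    refine hx (Finset.mem_image.2 ⟨p, Finset.mem_Icc.2 ⟨h3, by omega⟩, funext fun t => ?_⟩)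
    have h5 := Nat.mod_add_div (t : ℕ) p
    have h6 := Nat.mod_lt (t : ℕ) h3
    have h7 : u.length - p + 1 + t % p + p * (t / p + 1) = u.length + t + 1 := by
      rw [Nat.mul_succ]; omega
    have h8 := hm.per.eq_add_mul (k := u.length - p + 1 + t % p) (by omega) (t / p + 1) (by omega)
    rw [h7, hxw] at h8
    have h9 := hu.letter_eq (u.length - p + 1 + t % p) (by omega) (by omega)
    exact (h8.trans h9).symm
  obtain ⟨Φ, hΦ, hΦ'⟩ := exists_extension_map hu
  obtain ⟨Ψ, hΨ, hΨ'⟩ := exists_extension_map hv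
  rw [numRuns, numRuns, ← hΦ.ncard_image, ← hΨ.ncard_image,
    ← Set.ncard_union_eq ?_ ((finite_isRun u).image _) ((finite_isRun v).image _)]
  · refine Set.ncard_le_ncard ?_ (finite_isRun w)
    rintro r (⟨⟨s, e⟩, hr, rfl⟩ | ⟨⟨s, e⟩, hr, rfl⟩)
    · exact (hΦ' s e hr).1
    · exact (hΨ' s e hr).1
  · rw [Set.disjoint_left]
    rintro r ⟨⟨s, e⟩, hr, rfl⟩ ⟨⟨s₂, e₂⟩, hr₂, heq⟩
    obtain ⟨-, p, h1, h2⟩ := hΦ' s e hr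
    obtain ⟨-, p₂, h3, h4⟩ := hΨ' s₂ e₂ hr₂
    have h5 := hend h1 h2
    rw [heq] at h4
    have h6 := h4.le_end
    omega

lemma numRuns_le_rho (w : List Bool) : numRuns w ≤ rho w.length := by
  have := Finset.le_sup (f := fun v : Fin w.length → Bool => numRuns (List.ofFn v))
    (Finset.mem_univ w.get)
  simpa [rho] using this

lemma exists_numRuns_eq_rho (n : ℕ) : ∃ w : List Bool, w.length = n ∧ numRuns w = rho n := by
  obtain ⟨v, -, hv⟩ := Finset.exists_mem_eq_sup (Finset.univ : Finset (Fin n → Bool))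
    Finset.univ_nonempty fun v => numRuns (List.ofFn v)
  exact ⟨List.ofFn v, by simp, hv.symm⟩

lemma rho_le (n : ℕ) : rho n ≤ n := by
  obtain ⟨w, hw, hr⟩ := exists_numRuns_eq_rho n
  have := numRuns_add_card_lostPositions_le w
  omega

lemma rho_add_le {a b L : ℕ} (hL : a < 2 ^ L) : rho a + rho b ≤ rho (a + L + b) := by
  obtain ⟨u, hu, hu'⟩ := exists_numRuns_eq_rho a
  obtain ⟨v, hv, hv'⟩ := exists_numRuns_eq_rho b
  obtain ⟨x, hx, h⟩ := exists_separator u v (L := L) (by omega)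
  have := numRuns_le_rho (u ++ x ++ v)
  rw [List.length_append, List.length_append, hu, hx, hv] at this
  omega

lemma lt_two_pow_two_mul_sqrt (a : ℕ) : a < 2 ^ (2 * a.sqrt) := by
  have h1 : a < (a.sqrt + 1) * (a.sqrt + 1) := Nat.lt_succ_sqrt a
  have h2 : a.sqrt + 1 ≤ 2 ^ a.sqrt := Nat.lt_two_pow_self
  rw [two_mul, pow_add]
  exact h1.trans_le (Nat.mul_le_mul h2 h2)

/-- The length of a block that consists of a word of length `m` and a separator. -/
def blockLength (m : ℕ) : ℕ := m + 2 * m.sqrt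

lemma mul_rho_le (m k r : ℕ) : k * rho m ≤ rho (k * blockLength m + r) := by
  induction k with
  | zero => simp
  | succ k ih =>
    have := rho_add_le (a := m) (b := k * blockLength m + r) (lt_two_pow_two_mul_sqrt m)
    rw [show m + 2 * m.sqrt + (k * blockLength m + r) = (k + 1) * blockLength m + r by
      rw [blockLength]; ring] at this
    rw [Nat.succ_mul]
    omega

lemma exists_tendsto_rho_div :
    ∃ l : ℝ, Filter.Tendsto (fun n : ℕ => (rho n : ℝ) / n) Filter.atTop (nhds l) := by
  set S : Set ℝ := Set.range fun m : ℕ => (rho m : ℝ) / blockLength m with hS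
  have hle1 : ∀ m : ℕ, (rho m : ℝ) / blockLength m ≤ 1 := by
    intro m
    refine div_le_one_of_le₀ ?_ (Nat.cast_nonneg _)
    exact_mod_cast (rho_le m).trans (Nat.le_add_right _ _)
  have hbdd : BddAbove S := ⟨1, by rintro _ ⟨m, rfl⟩; exact hle1 m⟩
  refine ⟨sSup S, tendsto_order.2 ⟨fun a ha => ?_, fun a ha => ?_⟩⟩
  · obtain ⟨_, ⟨m, rfl⟩, hm⟩ := exists_lt_of_lt_csSup (Set.range_nonempty _) ha
    simp only at hm
    set q : ℝ := (rho m : ℝ) / blockLength m with hq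
    have hlim : Filter.Tendsto (fun n : ℕ => q - (blockLength m : ℝ) / n) Filter.atTop
        (nhds (q - 0)) :=
      tendsto_const_nhds.sub (tendsto_const_div_atTop_nhds_zero_nat _)
    rw [sub_zero] at hlim
    filter_upwards [hlim.eventually (lt_mem_nhds hm), Filter.eventually_gt_atTop 0] with n hn hn0
    refine hn.trans_le ?_
    have hn0' : (0 : ℝ) < n := by exact_mod_cast hn0
    rw [le_div_iff₀ hn0', sub_mul, div_mul_cancel₀ _ hn0'.ne']
    have hq0 : 0 ≤ q := by positivity
    rcases Nat.eq_zero_or_pos (blockLength m) with h0 | h0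
    · simp [hq, h0]
    have h0' : (0 : ℝ) < blockLength m := by exact_mod_cast h0
    have h1 := mul_rho_le m (n / blockLength m) (n % blockLength m)
    rw [Nat.div_add_mod'] at h1
    have h2 : ((n / blockLength m : ℕ) : ℝ) * rho m ≤ rho n := by exact_mod_cast h1
    have h3 : (rho m : ℝ) = q * blockLength m := by rw [hq, div_mul_cancel₀ _ h0'.ne']
    have h4 : (n : ℝ) ≤ (n / blockLength m : ℕ) * (blockLength m : ℝ) + blockLength m := by
      have h5 := Nat.div_add_mod' n (blockLength m)
      have h6 := Nat.mod_lt n h0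
      exact_mod_cast by omega
    rw [h3] at h2
    have h7 := mul_le_mul_of_nonneg_left h4 hq0
    have h8 := mul_le_mul_of_nonneg_right (hle1 m) h0'.le
    rw [← hq] at h8
    linarith
  · have h0 : 0 ≤ sSup S := by
      refine le_csSup_of_le hbdd ⟨0, rfl⟩ (by positivity)
    have hlim : Filter.Tendsto (fun n : ℕ => sSup S * (1 + 2 * (√(n : ℝ))⁻¹)) Filter.atTop
        (nhds (sSup S * (1 + 2 * 0))) := by
      refine Filter.Tendsto.const_mul _ (Filter.Tendsto.const_add _ (Filter.Tendsto.const_mul _ ?_))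
      exact tendsto_inv_atTop_zero.comp
        (Real.tendsto_sqrt_atTop.comp tendsto_natCast_atTop_atTop)
    rw [mul_zero, add_zero, mul_one] at hlim
    filter_upwards [hlim.eventually (gt_mem_nhds ha), Filter.eventually_gt_atTop 0] with n hn hn0
    refine lt_of_le_of_lt ?_ hn
    have hn0' : (0 : ℝ) < n := by exact_mod_cast hn0
    have hb : (0 : ℝ) < blockLength n := by
      exact_mod_cast hn0.trans_le (Nat.le_add_right _ _)
    have h1 : (rho n : ℝ) ≤ sSup S * blockLength n :=
      (div_le_iff₀ hb).1 (le_csSup hbdd ⟨n, rfl⟩)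
    have h2 : (blockLength n : ℝ) ≤ (1 + 2 * (√(n : ℝ))⁻¹) * n := by
      have h3 : (√(n : ℝ))⁻¹ * n = √(n : ℝ) := by
        have := Real.sqrt_pos.2 hn0'
        rw [inv_mul_eq_iff_eq_mul₀ this.ne', Real.mul_self_sqrt hn0'.le]
      rw [add_mul, mul_assoc, h3, one_mul, blockLength]
      push_cast
      have := Real.nat_sqrt_le_real_sqrt (a := n)
      linarith
    rw [div_le_iff₀ hn0', mul_assoc]
    exact h1.trans (mul_le_mul_of_nonneg_left h2 h0)

end LostPositions

theorem mainTheorem2 (d : ℝ) (hd : LostPositions.N d ≠ ⊤) :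
    ∃ l : ℝ, Filter.Tendsto (fun n : ℕ => (LostPositions.rho n : ℝ) / (n : ℝ))
        Filter.atTop (nhds l) ∧ l < 1 - 1 / d := by
  obtain ⟨l, hl⟩ := LostPositions.exists_tendsto_rho_div
  obtain ⟨δ, hδ, B, hB⟩ := LostPositions.exists_card_lostPositions_ge hd
  refine ⟨l, hl, lt_of_le_of_lt (b := 1 - δ) ?_ (by linarith)⟩
  have hlim : Filter.Tendsto (fun n : ℕ => 1 - δ + δ * B / (n : ℝ)) Filter.atTop
      (nhds (1 - δ + 0)) :=
    tendsto_const_nhds.add (tendsto_const_div_atTop_nhds_zero_nat _)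
  rw [add_zero] at hlim
  refine le_of_tendsto_of_tendsto hl hlim ?_
  filter_upwards [Filter.eventually_gt_atTop 0] with n hn
  have hn0 : (0 : ℝ) < n := by exact_mod_cast hn
  obtain ⟨w, rfl, hw⟩ := LostPositions.exists_numRuns_eq_rho n
  have h1 : (LostPositions.numRuns w : ℝ) + (LostPositions.lostPositions w).card ≤ w.length := by
    exact_mod_cast LostPositions.numRuns_add_card_lostPositions_le w
  have h2 := hB w
  rw [← hw, div_le_iff₀ hn0, add_mul, div_mul_cancel₀ _ hn0.ne']
  linarith
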